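/- Let $p_1,p_2,p_3,p_4$ be pairwise coprime positive integers and put $P=p_1p_2p_3p_4$. For $\vec\ell=(\ell_1,\ell_2,\ell_3,\ell_4)\in\mathbb Z^4$ with $0<\ell_j<p_j$ let $\chi_{2P}^{\vec\ell}$ be the function on $\mathbb Z$ of period $2P$ with $$\chi_{2P}^{\vec\ell}(n)=\begin{cases}-\prod_{j=1}^4\varepsilon_j & \text{if } n\equiv P\Bigl(1+\sum_{j=1}^4\varepsilon_j\frac{\ell_j}{p_j}\Bigr)\bmod 2P \text{ with } \varepsilon_j\in\{1,-1\},\\ 0&\text{otherwise,}\end{cases}$$ and define the Eichler integral $$\widetilde\Phi_{\vec p}^{\vec\ell}(\tau)=\sum_{n=0}^\infty n\,\chi_{2P}^{\vec\ell}(n)\,e^{2\pi i\tau n^2/(4P)}\qquad(\operatorname{Im}\tau>0).$$ Let $N$ be any integer. Then every limiting value $\widetilde\Phi_{\vec p}^{\vec\ell}(N)=\lim_{t\downarrow0}\widetilde\Phi_{\vec p}^{\vec\ell}(N+it)$ exists, and the number $\gamma(p_1,p_2,p_3,p_4)$ of distinct functions among the $\widetilde\Phi_{\vec p}^{\vec\ell}$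 whose limiting value at $N$ is nonzero does not depend on $N$ and is given by $$\begin{aligned}\gamma(p_1,p_2,p_3,p_4)={}&-\frac38+\frac P{12}-\frac P{24}\sum_{j=1}^4\frac{1+p_j}{p_j^2}-\frac1{24P}\Bigl(1-\sum_{j=1}^4p_j\Bigr)+\frac P{24}\sum_{j\ne k}\frac1{p_j^2p_k}\\&+\frac12\sum_{j=1}^4 s\Bigl(\frac P{p_j},p_j\Bigr)-\frac12\sum_{j\ne k}s\Bigl(\frac P{p_jp_k},p_j\Bigr),\end{aligned}$$ where the sums over $j\neq k$ run over ordered pairs of distinct indices in $\{1,2,3,4\}$. Here $s(b,a)=\sum_{k=1}^{a}\bigl(\!\bigl(\tfrac ka\bigr)\!\bigr)\bigl(\!\bigl(\tfrac{kb}a\bigr)\!\bigr)$ is the Dedekind sum, with $((x))=x-\lfloor x\rfloor-\frac12$ for $x\notin\mathbb Z$ and $((x))=0$ for $x\in\mathbb Z$. -/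

import Mathlib

open scoped Topology UpperHalfPlane

noncomputable section

namespace SeifertEichler

/-- The sawtooth function `((x))`. -/
def sawtooth (x : ℝ) : ℝ :=
  open Classical in
  if ∃ m : ℤ, (m : ℝ) = x then 0 else x - (⌊x⌋ : ℝ) - 1 / 2

/-- The Dedekind sum `s(b, a) = ∑_{k=1}^{a} ((k / a)) ((k b / a))`. -/
def dedekindSum (b : ℤ) (a : ℕ) : ℝ :=
  ∑ k ∈ Finset.Icc 1 a, sawtooth ((k : ℝ) / (a : ℝ)) * sawtooth ((k : ℝ) * (b : ℝ) / (a : ℝ))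

/-- `P = p₁ p₂ p₃ p₄`. -/
def bigP (p : Fin 4 → ℕ) : ℕ := ∏ j, p j

/-- The quadruples `ℓ ∈ ℤ⁴` with `0 < ℓ_j < p_j`. -/
def Admissible (p : Fin 4 → ℕ) (l : Fin 4 → ℤ) : Prop :=
  ∀ j, 0 < l j ∧ l j < (p j : ℤ)

/-- The integer `P (1 + ∑ⱼ εⱼ ℓⱼ / pⱼ)`; the division `P / pⱼ` is exact. -/
def residue (p : Fin 4 → ℕ) (l : Fin 4 → ℤ) (ε : Fin 4 → ℤˣ) : ℤ :=
  (bigP p : ℤ) + ∑ j, (ε j : ℤ) * l j * ((bigP p / p j : ℕ) : ℤ)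

/-- The even periodic function `χ_{2P}^ℓ`: its value at `n` is `-∏ⱼ εⱼ` if
`n ≡ P (1 + ∑ⱼ εⱼ ℓⱼ / pⱼ) mod 2P` for signs `εⱼ = ±1`, and `0` otherwise.
(For pairwise coprime `pⱼ` and `0 < ℓⱼ < pⱼ` the sixteen residues are distinct, so the sum below
has at most one nonzero term.) -/
def chi (p : Fin 4 → ℕ) (l : Fin 4 → ℤ) (n : ℤ) : ℤ :=
  ∑ ε : Fin 4 → ℤˣ,
    if n ≡ residue p l ε [ZMOD (2 * (bigP p : ℤ))] then -∏ j, (ε j : ℤ) else 0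

/-- The Eichler integral `Φ̃_p^ℓ(τ) = ∑_{n ≥ 0} n χ_{2P}^ℓ(n) q^{n² / 4P}`, `q = exp(2πiτ)`,
as a function on the upper half plane. -/
def eichlerIntegral (p : Fin 4 → ℕ) (l : Fin 4 → ℤ) (τ : ℍ) : ℂ :=
  ∑' n : ℕ, (n : ℂ) * (chi p l (n : ℤ) : ℂ) *
    Complex.exp (2 * (Real.pi : ℂ) * Complex.I * (τ : ℂ) *
      ((n : ℂ) ^ 2 / (4 * (bigP p : ℂ))))

/-- `f` has the limiting value `L` at the real point `x`, i.e. `f(x + i t) → L` as `t ↓ 0`. -/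
def HasLimitingValue (f : ℍ → ℂ) (x : ℝ) (L : ℂ) : Prop :=
  Filter.Tendsto
    (fun t : ℝ => f (UpperHalfPlane.ofComplex ((x : ℂ) + (t : ℂ) * Complex.I)))
    (𝓝[>] (0 : ℝ)) (𝓝 L)

/-- The number `γ(p₁, p₂, p₃, p₄)` of Eichler integrals `Φ̃_p^ℓ` (counted as functions on the upper
half plane) which have a nonzero limiting value as `τ → N`. -/
def gammaCount (p : Fin 4 → ℕ) (N : ℤ) : ℕ :=
  Set.ncard {f : ℍ → ℂ |
    (∃ l : Fin 4 → ℤ, Admissible p l ∧ f = eichlerIntegral p l) ∧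
      ∃ L : ℂ, L ≠ 0 ∧ HasLimitingValue f (N : ℝ) L}

end SeifertEichler

end

/-!
Write `P = p₁p₂p₃p₄`, and call the replacement of `ℓⱼ` by `pⱼ - ℓⱼ` at an even number of indices `j`
an even flip.

*Limiting values.* All `n` with `χ(n) ≠ 0` have the same square modulo `4P`, so above an integer
`N` the Eichler integral is a unimodular constant times `∑ n χ(n) exp(-a n²)` with `a → 0⁺`
(`eichlerIntegral_vertical`). The function `χ` is the second difference of a periodic function of
mean zero, `chiPot`, built from the Bernoulli function `B₂`. Three summations by parts, with the
third differences of `x exp(-a x²)` dominated by a multiple of `1/x²`, show that the sum tends to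
`chiPot 0` (`tendsto_tsum_chi_mul_gaussMoment`). In particular the nonvanishing of the limit does
not depend on `N`.

*Which limits vanish.* The coefficients of the Eichler integral can be recovered from its values,
and `χ` determines `ℓ` up to even flips (`eichlerIntegral_eq_iff`, `chi_eq_chi_iff`). These act
freely, so every function comes from exactly eight `ℓ`. Choosing in an orbit the `ℓ` with the least
`T = ∑ ℓⱼ / pⱼ` makes all pair sums `ℓᵢ / pᵢ + ℓⱼ / pⱼ` smaller than `1`; then only five of the
sixteen terms of `chiPot 0` (up to sign) can leave the range where `B₂({x})` is quadratic, and the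
limit vanishes exactly when `T < 1` (`chiPot_eq_zero_iff`). At most one element of an orbit has
`T < 1`, so `γ` is `∏ (pⱼ - 1) / 8` minus the number of lattice points of the open tetrahedron
(`gammaCount_eq`).

*Lattice points.* Since `⌊T⌋ - 3/2 = ∑ ((ℓⱼ / pⱼ)) - ((T))` takes the values `±3/2` and `±1/2`, the
sum of its square over all `ℓ` determines the number of `ℓ` with `T < 1`
(`sum_sq_eq_card_tetra`). Expanding the square and summing over one coordinate at a time with the
distribution relation of `((x))` leaves Dedekind sums (`sum_sq_four`). Those of the form
`s(pₖ, pⱼ)` occur in pairs and are removed by reciprocity, which follows from the same argument in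
two variables (`sawCorr_reciprocity`).
-/

namespace SeifertEichler

noncomputable section

open Filter

/-! ### Gaussian sums and summation by parts -/

/-- `x exp(-a x²)`, the profile of the Eichler integrals along vertical lines. -/
def gaussMoment (a x : ℝ) : ℝ := x * Real.exp (-(a * x ^ 2))

lemma exists_deriv_eq_fwdDiff {f f' : ℝ → ℝ} (hf : ∀ x, HasDerivAt f (f' x) x) (x : ℝ) :
    ∃ y, x < y ∧ fwdDiff 1 f x = f' y := by
  obtain ⟨y, hy, h⟩ := exists_hasDerivAt_eq_slope f f' (lt_add_one x)
    (fun z _ => (hf z).continuousAt.continuousWithinAt) (fun z _ => hf z)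
  exact ⟨y, hy.1, by rw [h]; simp [fwdDiff]⟩

lemma hasDerivAt_fwdDiff {f f' : ℝ → ℝ} (hf : ∀ x, HasDerivAt f (f' x) x) (x : ℝ) :
    HasDerivAt (fwdDiff 1 f) (fwdDiff 1 f' x) x :=
  ((hf (x + 1)).comp_add_const x 1).sub (hf x)

lemma exists_third_deriv_eq_fwdDiff {f f₁ f₂ f₃ : ℝ → ℝ} (h₁ : ∀ x, HasDerivAt f (f₁ x) x)
    (h₂ : ∀ x, HasDerivAt f₁ (f₂ x) x) (h₃ : ∀ x, HasDerivAt f₂ (f₃ x) x) (x : ℝ) :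
    ∃ y, x < y ∧ (fwdDiff 1)^[3] f x = f₃ y := by
  obtain ⟨y, hy, e⟩ := exists_deriv_eq_fwdDiff
    (hasDerivAt_fwdDiff (hasDerivAt_fwdDiff h₁)) x
  obtain ⟨z, hz, e'⟩ := exists_deriv_eq_fwdDiff (hasDerivAt_fwdDiff h₂) y
  obtain ⟨w, hw, e''⟩ := exists_deriv_eq_fwdDiff h₃ z
  exact ⟨w, by linarith, by simp only [Function.iterate_succ, Function.iterate_zero,
    Function.comp, id, e, e', e'']⟩

lemma hasDerivAt_exp_neg_mul_sq (a x : ℝ) :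
    HasDerivAt (fun x => Real.exp (-(a * x ^ 2))) (-(2 * a * x) * Real.exp (-(a * x ^ 2))) x := by
  have h : HasDerivAt (fun x : ℝ => -(a * x ^ 2)) (-(2 * a * x)) x := by
    have := (((hasDerivAt_id x).pow 2).const_mul a).neg
    refine this.congr_deriv ?_
    simp; ring
  exact h.exp.congr_deriv (by ring)

lemma pow_mul_exp_neg_le_factorial {y : ℝ} (hy : 0 ≤ y) (k : ℕ) :
    y ^ k * Real.exp (-y) ≤ (k.factorial : ℝ) := by
  have h := Real.pow_div_factorial_le_exp y hy k
  have hk : (0 : ℝ) < k.factorial := by positivity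
  rw [div_le_iff₀ hk] at h
  rw [Real.exp_neg, ← div_eq_mul_inv, div_le_iff₀ (Real.exp_pos y)]
  linarith

/-- The third differences of `x exp(-a x²)` are `O(1/x²)` uniformly in `a > 0`: this is the
domination that makes the limit `a → 0` computable after three summations by parts. -/
lemma abs_fwdDiff_gaussMoment_le {a x : ℝ} (ha : 0 < a) (hx : 0 < x) :
    |(fwdDiff 1)^[3] (gaussMoment a) x| ≤ 102 / x ^ 2 := by
  have hE := hasDerivAt_exp_neg_mul_sq a
  have h₁ : ∀ x, HasDerivAt (gaussMoment a)
      ((1 - 2 * a * x ^ 2) * Real.exp (-(a * x ^ 2))) x := fun x =>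
    ((hasDerivAt_id x).mul (hE x)).congr_deriv (by simp; ring)
  have h₂ : ∀ x, HasDerivAt (fun x => (1 - 2 * a * x ^ 2) * Real.exp (-(a * x ^ 2)))
      ((-6 * a * x + 4 * a ^ 2 * x ^ 3) * Real.exp (-(a * x ^ 2))) x := fun x => by
    have hp : HasDerivAt (fun x : ℝ => 1 - 2 * a * x ^ 2) (-(4 * a * x)) x :=
      ((((hasDerivAt_id x).pow 2).const_mul (2 * a)).const_sub 1).congr_deriv (by simp; ring)
    exact (hp.mul (hE x)).congr_deriv (by ring)
  have h₃ : ∀ x, HasDerivAt (fun x => (-6 * a * x + 4 * a ^ 2 * x ^ 3) * Real.exp (-(a * x ^ 2)))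
      ((-6 * a + 24 * a ^ 2 * x ^ 2 - 8 * a ^ 3 * x ^ 4) * Real.exp (-(a * x ^ 2))) x :=
    fun x => by
    have hp : HasDerivAt (fun x : ℝ => -6 * a * x + 4 * a ^ 2 * x ^ 3)
        (-6 * a + 12 * a ^ 2 * x ^ 2) x :=
      (((hasDerivAt_id x).const_mul (-6 * a)).add
        (((hasDerivAt_id x).pow 3).const_mul (4 * a ^ 2))).congr_deriv (by simp; ring)
    exact (hp.mul (hE x)).congr_deriv (by ring)
  obtain ⟨y, hy, e⟩ := exists_third_deriv_eq_fwdDiff h₁ h₂ h₃ x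
  have hy0 : 0 < y := hx.trans hy
  rw [e]
  refine le_trans ?_ (div_le_div_of_nonneg_left (by norm_num) (by positivity)
    (pow_le_pow_left₀ hx.le hy.le 2))
  rw [le_div_iff₀ (by positivity)]
  set v := a * y ^ 2 with hv
  have hv0 : 0 ≤ v := by positivity
  have b1 := pow_mul_exp_neg_le_factorial hv0 1
  have b2 := pow_mul_exp_neg_le_factorial hv0 2
  have b3 := pow_mul_exp_neg_le_factorial hv0 3
  norm_num [Nat.factorial] at b1 b2 b3
  have hE0 := (Real.exp_pos (-v)).le
  have c1 : 0 ≤ v * Real.exp (-v) := by positivity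
  have c2 : 0 ≤ v ^ 2 * Real.exp (-v) := by positivity
  have c3 : 0 ≤ v ^ 3 * Real.exp (-v) := by positivity
  have key : (-6 * a + 24 * a ^ 2 * y ^ 2 - 8 * a ^ 3 * y ^ 4) * Real.exp (-v) * y ^ 2
      = -6 * (v * Real.exp (-v)) + 24 * (v ^ 2 * Real.exp (-v))
        - 8 * (v ^ 3 * Real.exp (-v)) := by
    rw [hv]; ring
  have habs : ∀ X : ℝ, |X| * y ^ 2 = |X * y ^ 2| := fun X => by
    rw [abs_mul, abs_of_pos (pow_pos hy0 2)]
  rw [habs, key, abs_le]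
  constructor <;> linarith

/-- Summation by parts against a bounded sequence. -/
lemma tsum_fwdDiff_mul {U g : ℕ → ℝ} {C : ℝ} (hU : ∀ n, |U n| ≤ C) (hg : Summable g) :
    ∑' n, fwdDiff 1 U n * g n = -(U 0 * g 0) - ∑' n, U (n + 1) * fwdDiff 1 g n := by
  have hb : ∀ {V f : ℕ → ℝ}, (∀ n, |V n| ≤ C) → Summable f → Summable fun n => V n * f n :=
    fun {V f} hV hf => Summable.of_norm_bounded (hf.abs.mul_left C) fun n => by
      rw [norm_mul, Real.norm_eq_abs, Real.norm_eq_abs]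
      exact mul_le_mul_of_nonneg_right (hV n) (abs_nonneg _)
  have s0 := hb hU hg
  have s1 := hb (V := fun n => U (n + 1)) (fun n => hU (n + 1)) hg
  have s2 : Summable fun n => U (n + 1) * g (n + 1) := (summable_nat_add_iff 1).2 s0
  have e : ∀ n, fwdDiff 1 U n * g n = U (n + 1) * g n - U n * g n := fun n => by
    simp [fwdDiff]; ring
  have e' : ∀ n, U (n + 1) * fwdDiff 1 g n = U (n + 1) * g (n + 1) - U (n + 1) * g n :=
    fun n => by simp [fwdDiff]; ring
  rw [tsum_congr e, tsum_congr e', s1.tsum_sub s0, s2.tsum_sub s1, s0.tsum_eq_zero_add]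
  ring

lemma summable_gaussMoment {a : ℝ} (ha : 0 < a) : Summable fun n : ℕ => gaussMoment a n := by
  have h := Real.summable_pow_mul_exp_neg_nat_mul 1 ha
  refine Summable.of_nonneg_of_le (fun n => by unfold gaussMoment; positivity) (fun n => ?_) h
  unfold gaussMoment
  rw [pow_one]
  refine mul_le_mul_of_nonneg_left (Real.exp_le_exp.2 ?_) (by positivity)
  have : (n : ℝ) ≤ (n : ℝ) ^ 2 := by exact_mod_cast Nat.le_self_pow two_ne_zero n
  nlinarith

lemma summable_fwdDiff {g : ℕ → ℝ} (hg : Summable g) : Summable (fwdDiff 1 g) :=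
  ((summable_nat_add_iff 1).2 hg).sub hg

lemma exists_bound_fwdDiff {U : ℕ → ℝ} (hU : ∃ C, ∀ n, |U n| ≤ C) :
    ∃ C, ∀ n, |fwdDiff 1 U n| ≤ C := by
  obtain ⟨C, hC⟩ := hU
  exact ⟨C + C, fun n => (abs_sub _ _).trans (add_le_add (hC _) (hC _))⟩

/-- If `χ(n + 1)` is the third difference of a bounded sequence `Z`, then `∑ n χ(n) exp(-a n²)`
converges for `a → 0⁺`, and the limit is `Z 1 - Z 0`. -/
theorem tendsto_tsum_fwdDiff_mul_gaussMoment {Z : ℕ → ℝ} {C : ℝ} (hZ : ∀ n, |Z n| ≤ C) :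
    Tendsto (fun a : ℝ => ∑' n : ℕ, (fwdDiff 1)^[3] Z n * gaussMoment a ((n : ℝ) + 1))
      (𝓝[>] 0) (𝓝 (Z 1 - Z 0)) := by
  have hcont : ∀ x : ℝ, Tendsto (fun a => gaussMoment a x) (𝓝[>] 0) (𝓝 x) := fun x => by
    have : Continuous fun a => gaussMoment a x := by unfold gaussMoment; fun_prop
    simpa [gaussMoment] using (this.tendsto 0).mono_left nhdsWithin_le_nhds
  obtain ⟨C₁, hC₁⟩ := exists_bound_fwdDiff ⟨C, hZ⟩
  obtain ⟨C₂, hC₂⟩ := exists_bound_fwdDiff ⟨C₁, hC₁⟩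
  have hC0 : 0 ≤ C := (abs_nonneg _).trans (hZ 0)
  set g : ℝ → ℕ → ℝ := fun a n => gaussMoment a ((n : ℝ) + 1) with hgdef
  have hg3 : ∀ a (n : ℕ), (fwdDiff 1)^[3] (g a) n
      = (fwdDiff 1)^[3] (gaussMoment a) ((n : ℝ) + 1) := fun a n => by
    simp only [Function.iterate_succ, Function.iterate_zero, Function.comp, id, fwdDiff, g]
    push_cast
    ring_nf
  -- every term tends to a third difference of the identity function, which is `0`
  have hrest : Tendsto (fun a : ℝ => ∑' n : ℕ, Z (n + 3) * (fwdDiff 1)^[3] (g a) n)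
      (𝓝[>] 0) (𝓝 (∑' _ : ℕ, 0)) := by
    have hs : Summable fun n : ℕ => C * (102 / ((n : ℝ) + 1) ^ 2) := by
      have := (summable_nat_add_iff 1).2 (Real.summable_one_div_nat_pow.2 one_lt_two)
      refine ((this.mul_left 102).mul_left C).congr fun n => ?_
      push_cast; ring
    refine tendsto_tsum_of_dominated_convergence hs (fun n => ?_) ?_
    · have : Tendsto (fun a => Z (n + 3) * (fwdDiff 1)^[3] (g a) n) (𝓝[>] 0)
          (𝓝 (Z (n + 3) * (((((n + 1 + 1 + 1 : ℕ) : ℝ) + 1) - (((n + 1 + 1 : ℕ) : ℝ) + 1)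
            - ((((n + 1 + 1 : ℕ) : ℝ) + 1) - (((n + 1 : ℕ) : ℝ) + 1)))
            - (((((n + 1 + 1 : ℕ) : ℝ) + 1) - (((n + 1 : ℕ) : ℝ) + 1))
            - ((((n + 1 : ℕ) : ℝ) + 1) - ((n : ℝ) + 1)))))) := by
        simp only [Function.iterate_succ, Function.iterate_zero, Function.comp, id, fwdDiff, g]
        exact (((((hcont _).sub (hcont _)).sub ((hcont _).sub (hcont _))).sub
          (((hcont _).sub (hcont _)).sub ((hcont _).sub (hcont _)))).const_mul _)
      convert this using 2
      push_cast; ring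
    · filter_upwards [self_mem_nhdsWithin] with a ha n
      rw [norm_mul, Real.norm_eq_abs, Real.norm_eq_abs, hg3]
      exact mul_le_mul (hZ _) (abs_fwdDiff_gaussMoment_le ha (by positivity)) (abs_nonneg _) hC0
  rw [tsum_zero] at hrest
  have hparts : ∀ a : ℝ, 0 < a → ∑' n : ℕ, (fwdDiff 1)^[3] Z n * g a n
      = -(fwdDiff 1 (fwdDiff 1 Z) 0 * g a 0) + fwdDiff 1 Z 1 * fwdDiff 1 (g a) 0
        - Z 2 * fwdDiff 1 (fwdDiff 1 (g a)) 0
        - ∑' n : ℕ, Z (n + 3) * (fwdDiff 1)^[3] (g a) n := fun a ha => by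
    have hs : Summable (g a) := by
      simpa [g] using (summable_nat_add_iff 1).2 (summable_gaussMoment ha)
    have e1 := tsum_fwdDiff_mul hC₂ hs
    have e2 := tsum_fwdDiff_mul (U := fun n => fwdDiff 1 Z (n + 1)) (fun n => hC₁ (n + 1))
      (summable_fwdDiff hs)
    have e3 := tsum_fwdDiff_mul (U := fun n => Z (n + 2)) (fun n => hZ (n + 2))
      (summable_fwdDiff (summable_fwdDiff hs))
    have i1 : ∀ n, fwdDiff 1 (fun n => fwdDiff 1 Z (n + 1)) n
      = fwdDiff 1 (fwdDiff 1 Z) (n + 1) := fun n => rfl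
    have i2 : ∀ n, fwdDiff 1 (fun n => Z (n + 2)) n = fwdDiff 1 Z (n + 1 + 1) := fun n => rfl
    simp only [i1] at e2
    simp only [i2] at e3
    simp only [Function.iterate_succ, Function.iterate_zero, Function.comp, id]
    rw [e1, e2, e3]
    ring
  have hlim : Tendsto (fun a : ℝ => -(fwdDiff 1 (fwdDiff 1 Z) 0 * g a 0)
      + fwdDiff 1 Z 1 * fwdDiff 1 (g a) 0 - Z 2 * fwdDiff 1 (fwdDiff 1 (g a)) 0
      - ∑' n : ℕ, Z (n + 3) * (fwdDiff 1)^[3] (g a) n) (𝓝[>] 0)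
      (𝓝 (-(fwdDiff 1 (fwdDiff 1 Z) 0 * (((0 : ℕ) : ℝ) + 1))
        + fwdDiff 1 Z 1 * ((((0 + 1 : ℕ) : ℝ) + 1) - (((0 : ℕ) : ℝ) + 1))
        - Z 2 * (((((0 + 1 + 1 : ℕ) : ℝ) + 1) - (((0 + 1 : ℕ) : ℝ) + 1))
          - ((((0 + 1 : ℕ) : ℝ) + 1) - (((0 : ℕ) : ℝ) + 1))) - 0)) := by
    refine Tendsto.sub (Tendsto.sub (Tendsto.add ?_ ?_) ?_) hrest
    · exact ((hcont _).const_mul _).neg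
    · exact ((hcont _).sub (hcont _)).const_mul _
    · exact (((hcont _).sub (hcont _)).sub ((hcont _).sub (hcont _))).const_mul _
  refine (hlim.congr' ?_).trans ?_
  · filter_upwards [self_mem_nhdsWithin] with a ha using (hparts a ha).symm
  · apply le_of_eq
    congr 1
    norm_num [fwdDiff]

/-! ### The periodic function `χ` and its second antidifference -/

/-- Reindexing a sum over a full period along any system of representatives `g i`, `i ∈ s`. -/
lemma sum_eq_sum_range_of_periodic {ι : Type*} {s : Finset ι} {g : ι → ℤ} {m : ℕ} (hm : 0 < m)
    (hcard : s.card = m) (hinj : ∀ i ∈ s, ∀ j ∈ s, (m : ℤ) ∣ g i - g j → i = j) {f : ℤ → ℝ}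
    (hf : Function.Periodic f (m : ℤ)) :
    ∑ i ∈ s, f (g i) = ∑ k ∈ Finset.range m, f (k : ℤ) := by
  have hm' : (m : ℤ) ≠ 0 := by exact_mod_cast hm.ne'
  have hnn : ∀ i, 0 ≤ g i % m := fun i => Int.emod_nonneg _ hm'
  have hinj' : Set.InjOn (fun i => (g i % m).toNat) s := fun i hi j hj h => by
    refine hinj i hi j hj (Int.ModEq.dvd ?_)
    have := congrArg (Nat.cast : ℕ → ℤ) h
    simp only [Int.toNat_of_nonneg (hnn _)] at this
    exact this.symm
  have himg : s.image (fun i => (g i % m).toNat) = Finset.range m := by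
    refine Finset.eq_of_subset_of_card_le (fun k hk => ?_) ?_
    · obtain ⟨i, -, rfl⟩ := Finset.mem_image.1 hk
      have := Int.emod_lt_of_pos (g i) (by exact_mod_cast hm : (0 : ℤ) < m)
      have := hnn i
      rw [Finset.mem_range]; omega
    · rw [Finset.card_image_of_injOn hinj', hcard, Finset.card_range]
  rw [← himg, Finset.sum_image hinj']
  refine Finset.sum_congr rfl fun i _ => ?_
  rw [Int.toNat_of_nonneg (hnn i), Int.emod_def]
  conv_rhs => rw [← hf.int_mul (g i / m) _]
  congr 1
  push_cast
  ring

/-- The `m`-periodic function `r (m - r) / (2 m)`, `r = n mod m`: up to an additive constant it is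
the Bernoulli function `-(m / 2) B₂({n / m})`. -/
def bernoulliPot (m : ℕ) (n : ℤ) : ℝ :=
  ((n % m : ℤ) : ℝ) * ((m : ℝ) - ((n % m : ℤ) : ℝ)) / (2 * m)

lemma bernoulliPot_periodic (m : ℕ) : Function.Periodic (bernoulliPot m) (m : ℤ) := fun n => by
  simp [bernoulliPot]

lemma bernoulliPot_of_range {m : ℕ} {n : ℤ} (h0 : 0 ≤ n) (h1 : n ≤ m) :
    bernoulliPot m n = (n : ℝ) * ((m : ℝ) - n) / (2 * m) := by
  rcases h1.lt_or_eq with h | rfl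
  · rw [bernoulliPot, Int.emod_eq_of_lt h0 h]
  · simp [bernoulliPot]

/-- The second difference of `bernoulliPot m` is the indicator of the multiples of `m` minus its
mean. -/
lemma bernoulliPot_second_diff {m : ℕ} (hm : 2 ≤ m) (n : ℤ) :
    bernoulliPot m (n + 1) - 2 * bernoulliPot m n + bernoulliPot m (n - 1)
      = (if (m : ℤ) ∣ n then 1 else 0) - 1 / m := by
  have hm0 : (m : ℝ) ≠ 0 := by positivity
  have hper := bernoulliPot_periodic m
  have hz : (0 : ℤ) < m := by omega
  obtain ⟨q, r, hr0, hr1, rfl⟩ : ∃ q r : ℤ, 0 ≤ r ∧ r < m ∧ n = r + q * m :=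
    ⟨n / m, n % m, Int.emod_nonneg _ hz.ne', Int.emod_lt_of_pos _ hz, by
      rw [mul_comm]; exact (Int.emod_add_mul_ediv n m).symm⟩
  have e : ∀ c : ℤ, bernoulliPot m (c + q * m) = bernoulliPot m c := fun c => by
    simpa using hper.int_mul q c
  have hd : (m : ℤ) ∣ r + q * m ↔ r = 0 := by
    rw [Int.dvd_add_left (Dvd.intro_left _ rfl)]
    exact ⟨fun h => Int.eq_zero_of_dvd_of_nonneg_of_lt hr0 hr1 h, fun h => h ▸ dvd_zero _⟩
  rw [show r + q * m + 1 = (r + 1) + q * m by ring, show r + q * m - 1 = (r - 1) + q * m by ring,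
    e, e, e]
  simp only [hd]
  have hm' : 0 < m := by omega
  rcases eq_or_ne r 0 with h | h
  · subst h
    rw [← hper (0 - 1), bernoulliPot_of_range (by omega) (by omega),
      bernoulliPot_of_range (by omega) (by omega),
      bernoulliPot_of_range (by omega) (by omega)]
    field_simp
    norm_num
    ring
  · rw [bernoulliPot_of_range (by omega) (by omega),
      bernoulliPot_of_range (by omega) (by omega),
      bernoulliPot_of_range (by omega) (by omega), if_neg h]
    push_cast
    field_simp
    ring

lemma sum_range_bernoulliPot_sub {m : ℕ} (hm : 0 < m) (c : ℤ) :
    ∑ k ∈ Finset.range m, bernoulliPot m ((k : ℤ) - c)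
      = ∑ k ∈ Finset.range m, bernoulliPot m (k : ℤ) := by
  refine sum_eq_sum_range_of_periodic (g := fun k : ℕ => (k : ℤ) - c) hm (Finset.card_range m)
    (fun i hi j hj h => ?_) (bernoulliPot_periodic m)
  rw [Finset.mem_range] at hi hj
  have h' : (m : ℤ) ∣ (i : ℤ) - j := by simpa using h
  have := Int.eq_zero_of_abs_lt_dvd h' (by rw [abs_lt]; omega)
  omega

lemma exists_bound_sum_range {Y : ℤ → ℝ} {m : ℕ} (hm : 0 < m) (hY : Function.Periodic Y (m : ℤ))
    (h0 : ∑ k ∈ Finset.range m, Y (k : ℤ) = 0) :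
    ∃ C, ∀ n : ℕ, |∑ k ∈ Finset.range n, Y (k : ℤ)| ≤ C := by
  have hper : Function.Periodic (fun n : ℕ => ∑ k ∈ Finset.range n, Y (k : ℤ)) m := fun n => by
    show ∑ k ∈ Finset.range (n + m), Y (k : ℤ) = _
    rw [add_comm, Finset.sum_range_add, h0, zero_add]
    refine Finset.sum_congr rfl fun k _ => ?_
    rw [← hY k, Nat.cast_add, add_comm]
  refine ⟨∑ j ∈ Finset.range m, |∑ k ∈ Finset.range j, Y (k : ℤ)|, fun n => ?_⟩
  have h := hper.map_mod_nat n
  rw [← h]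
  exact Finset.single_le_sum (f := fun j => |∑ k ∈ Finset.range j, Y (k : ℤ)|)
    (fun j _ => abs_nonneg _) (Finset.mem_range.2 (Nat.mod_lt n hm))

/-- Product of the four signs. -/
def sgn (ε : Fin 4 → ℤˣ) : ℤ := ∏ j, (ε j : ℤ)

/-- Sums over four signs, written out as an iterated sum. -/
lemma sum_signs {A : Type*} [AddCommMonoid A] (f : (Fin 4 → ℤˣ) → A) :
    ∑ ε, f ε = ∑ a : ℤˣ, ∑ b : ℤˣ, ∑ c : ℤˣ, ∑ d : ℤˣ, f ![a, b, c, d] := by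
  let e : (ℤˣ × ℤˣ × ℤˣ × ℤˣ) ≃ (Fin 4 → ℤˣ) :=
    { toFun := fun x => ![x.1, x.2.1, x.2.2.1, x.2.2.2]
      invFun := fun v => (v 0, v 1, v 2, v 3)
      left_inv := fun x => rfl
      right_inv := fun v => by ext i; fin_cases i <;> rfl }
  rw [← Equiv.sum_comp e]
  simp only [Fintype.sum_prod_type]
  rfl

lemma sum_unitsInt {A : Type*} [AddCommMonoid A] (f : ℤˣ → A) : ∑ a, f a = f 1 + f (-1) := by
  rw [show (Finset.univ : Finset ℤˣ) = {1, -1} from rfl, Finset.sum_pair (by decide)]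

lemma sum_sgn : ∑ ε, sgn ε = 0 := by decide

lemma sgn_sq (ε : Fin 4 → ℤˣ) : sgn ε = 1 ∨ sgn ε = -1 := by
  unfold sgn
  rw [← Units.coe_prod]
  rcases Int.units_eq_one_or (∏ j, ε j) with h | h <;> simp [h]

lemma chi_eq (p : Fin 4 → ℕ) (l : Fin 4 → ℤ) (n : ℤ) :
    chi p l n = ∑ ε, if (2 * bigP p : ℤ) ∣ n - residue p l ε then -sgn ε else 0 := by
  unfold chi sgn
  refine Finset.sum_congr rfl fun ε _ => ?_
  congr 1
  rw [eq_iff_iff]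
  exact ⟨fun h => h.symm.dvd, fun h => (Int.modEq_iff_dvd.2 h).symm⟩

lemma chi_periodic (p : Fin 4 → ℕ) (l : Fin 4 → ℤ) :
    Function.Periodic (chi p l) (2 * bigP p : ℤ) := fun n => by
  rw [chi_eq, chi_eq]
  refine Finset.sum_congr rfl fun ε _ => ?_
  congr 1
  rw [eq_iff_iff, show n + 2 * (bigP p : ℤ) - residue p l ε
    = (n - residue p l ε) + 2 * bigP p by ring]
  exact Int.dvd_add_left dvd_rfl

lemma abs_chi_le (p : Fin 4 → ℕ) (l : Fin 4 → ℤ) (n : ℤ) : |chi p l n| ≤ 16 := by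
  rw [chi_eq]
  refine (Finset.abs_sum_le_sum_abs _ _).trans ?_
  refine (Finset.sum_le_card_nsmul _ _ 1 fun ε _ => ?_).trans (by simp)
  split_ifs
  · rcases sgn_sq ε with h | h <;> simp [h]
  · simp

lemma summable_chi_mul_gaussMoment (p : Fin 4 → ℕ) (l : Fin 4 → ℤ) {a : ℝ} (ha : 0 < a) :
    Summable fun n : ℕ => (chi p l (n : ℤ) : ℝ) * gaussMoment a n := by
  refine Summable.of_norm_bounded ((summable_gaussMoment ha).abs.mul_left 16) fun n => ?_
  rw [norm_mul, Real.norm_eq_abs, Real.norm_eq_abs]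
  exact mul_le_mul_of_nonneg_right (by exact_mod_cast abs_chi_le p l n) (abs_nonneg _)

/-- The periodic second antidifference of `χ` of mean zero. -/
def chiPot (p : Fin 4 → ℕ) (l : Fin 4 → ℤ) (n : ℤ) : ℝ :=
  ∑ ε, -(sgn ε : ℝ) * bernoulliPot (2 * bigP p) (n - residue p l ε)

lemma bigP_pos {p : Fin 4 → ℕ} (hpos : ∀ j, 0 < p j) : 0 < bigP p :=
  Finset.prod_pos fun j _ => hpos j

lemma chiPot_second_diff {p : Fin 4 → ℕ} (hpos : ∀ j, 0 < p j) (l : Fin 4 → ℤ) (n : ℤ) :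
    chiPot p l (n + 1) - 2 * chiPot p l n + chiPot p l (n - 1) = chi p l n := by
  have hP := bigP_pos hpos
  have h0 : ∑ ε, (sgn ε : ℝ) * (1 / ((2 * bigP p : ℕ) : ℝ)) = 0 := by
    rw [← Finset.sum_mul]
    have : ∑ ε, (sgn ε : ℝ) = 0 := by exact_mod_cast sum_sgn
    rw [this, zero_mul]
  rw [chi_eq, chiPot, chiPot, chiPot, Finset.mul_sum, ← Finset.sum_sub_distrib,
    ← Finset.sum_add_distrib, Int.cast_sum]
  rw [← add_zero (∑ ε, ((if (2 * bigP p : ℤ) ∣ n - residue p l ε then -sgn ε else 0 : ℤ) : ℝ)),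
    ← h0, ← Finset.sum_add_distrib]
  refine Finset.sum_congr rfl fun ε _ => ?_
  have := bernoulliPot_second_diff (m := 2 * bigP p) (by omega) (n - residue p l ε)
  rw [show n + 1 - residue p l ε = n - residue p l ε + 1 by ring,
    show n - 1 - residue p l ε = n - residue p l ε - 1 by ring]
  push_cast at this ⊢
  split_ifs at this ⊢ <;> linear_combination (-(sgn ε : ℝ)) * this

lemma chiPot_periodic (p : Fin 4 → ℕ) (l : Fin 4 → ℤ) :
    Function.Periodic (chiPot p l) ((2 * bigP p : ℕ) : ℤ) := fun n => by
  unfold chiPot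
  refine Finset.sum_congr rfl fun ε _ => ?_
  rw [add_sub_right_comm, bernoulliPot_periodic]

lemma sum_range_chiPot {p : Fin 4 → ℕ} (hpos : ∀ j, 0 < p j) (l : Fin 4 → ℤ) :
    ∑ k ∈ Finset.range (2 * bigP p), chiPot p l (k : ℤ) = 0 := by
  have hP := bigP_pos hpos
  unfold chiPot
  rw [Finset.sum_comm]
  have : ∀ ε, ∑ k ∈ Finset.range (2 * bigP p), -(sgn ε : ℝ) * bernoulliPot (2 * bigP p)
      ((k : ℤ) - residue p l ε) = -(sgn ε : ℝ) * ∑ k ∈ Finset.range (2 * bigP p),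
        bernoulliPot (2 * bigP p) (k : ℤ) := fun ε => by
    rw [← Finset.mul_sum, sum_range_bernoulliPot_sub (by omega)]
  rw [Finset.sum_congr rfl fun ε _ => this ε, ← Finset.sum_mul, Finset.sum_neg_distrib]
  have : ∑ ε, (sgn ε : ℝ) = 0 := by exact_mod_cast sum_sgn
  rw [this, neg_zero, zero_mul]

/-- The Gaussian-regularised value of `∑ n χ(n)` is the value at `0` of the mean-zero second
antidifference of `χ`. -/
theorem tendsto_tsum_chi_mul_gaussMoment {p : Fin 4 → ℕ} (hpos : ∀ j, 0 < p j) (l : Fin 4 → ℤ) :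
    Tendsto (fun a : ℝ => ∑' n : ℕ, (chi p l (n : ℤ) : ℝ) * gaussMoment a n) (𝓝[>] 0)
      (𝓝 (chiPot p l 0)) := by
  have hP := bigP_pos hpos
  obtain ⟨C, hC⟩ := exists_bound_sum_range (by omega) (chiPot_periodic p l)
    (sum_range_chiPot hpos l)
  have h := tendsto_tsum_fwdDiff_mul_gaussMoment hC
  simp only [Finset.sum_range_one, Finset.sum_range_zero, sub_zero, Nat.cast_zero] at h
  refine h.congr' ?_
  filter_upwards [self_mem_nhdsWithin] with a ha
  rw [(summable_chi_mul_gaussMoment p l ha).tsum_eq_zero_add]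
  have h0 : gaussMoment a ((0 : ℕ) : ℝ) = 0 := by simp [gaussMoment]
  rw [h0, mul_zero, zero_add]
  refine tsum_congr fun n => ?_
  push_cast
  congr 1
  rw [← Nat.cast_one (R := ℤ), ← Nat.cast_add, ← chiPot_second_diff hpos]
  simp only [Function.iterate_succ, Function.iterate_zero, Function.comp, id, fwdDiff,
    Finset.sum_range_succ]
  push_cast
  rw [add_sub_cancel_right, add_assoc (n : ℤ) 1 1, one_add_one_eq_two]
  ring

/-! ### Limiting values and uniqueness of the Eichler integrals -/

variable {p : Fin 4 → ℕ}

lemma dvd_bigP (p : Fin 4 → ℕ) (j : Fin 4) : p j ∣ bigP p :=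
  Finset.dvd_prod_of_mem p (Finset.mem_univ j)

/-- The cofactor `P / pⱼ` as an integer. -/
def cof (p : Fin 4 → ℕ) (j : Fin 4) : ℤ := ((bigP p / p j : ℕ) : ℤ)

lemma mul_cof (p : Fin 4 → ℕ) (j : Fin 4) : (p j : ℤ) * cof p j = bigP p := by
  unfold cof
  exact_mod_cast Nat.mul_div_cancel' (dvd_bigP p j)

lemma cof_eq_prod_erase (hpos : ∀ j, 0 < p j) (j : Fin 4) :
    cof p j = ∏ k ∈ Finset.univ.erase j, (p k : ℤ) := by
  have h : (p j : ℤ) ≠ 0 := by exact_mod_cast (hpos j).ne'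
  refine mul_left_cancel₀ h ?_
  rw [mul_cof, Finset.mul_prod_erase _ (fun k => (p k : ℤ)) (Finset.mem_univ j), bigP]
  push_cast; rfl

lemma dvd_cof (hpos : ∀ j, 0 < p j) {j k : Fin 4} (h : k ≠ j) : (p k : ℤ) ∣ cof p j := by
  rw [cof_eq_prod_erase hpos]
  exact Finset.dvd_prod_of_mem (fun k => (p k : ℤ)) (by simp [h])

lemma isCoprime_cof (hpos : ∀ j, 0 < p j) (hcop : ∀ j k, j ≠ k → Nat.Coprime (p j) (p k))
    (j : Fin 4) : IsCoprime (p j : ℤ) (cof p j) := by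
  rw [cof_eq_prod_erase hpos]
  refine IsCoprime.prod_right fun k hk => Nat.isCoprime_iff_coprime.2 (hcop j k ?_)
  exact (Finset.ne_of_mem_erase hk).symm

lemma bigP_dvd_cof_mul_cof (hpos : ∀ j, 0 < p j) {j k : Fin 4} (h : j ≠ k) :
    (bigP p : ℤ) ∣ cof p j * cof p k := by
  obtain ⟨c, hc⟩ := dvd_cof hpos h
  exact ⟨c, by rw [hc, ← mul_cof p j]; ring⟩

lemma residue_eq (p : Fin 4 → ℕ) (l : Fin 4 → ℤ) (ε : Fin 4 → ℤˣ) :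
    residue p l ε = bigP p + ∑ j, (ε j : ℤ) * (l j * cof p j) := by
  unfold residue cof
  simp only [mul_assoc]

/-- All sixteen residues have the same square modulo `4P`. -/
lemma residue_sq_modEq (hpos : ∀ j, 0 < p j) (l : Fin 4 → ℤ) (ε : Fin 4 → ℤˣ) :
    (4 * bigP p : ℤ) ∣ residue p l ε ^ 2 - residue p l 1 ^ 2 := by
  -- `e j` is `1` where the sign is negative and `0` elsewhere
  have hε : ∀ j, ∃ e : ℤ, (ε j : ℤ) = 1 - 2 * e ∧ e * (1 - e) = 0 := fun j => by
    rcases Int.units_eq_one_or (ε j) with h | h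
    · exact ⟨0, by simp [h]⟩
    · exact ⟨1, by simp [h]⟩
  choose e he hee using hε
  set a : Fin 4 → ℤ := fun j => l j * cof p j with ha
  have h1 : residue p l ε - residue p l 1 = -2 * ∑ j, e j * a j := by
    rw [residue_eq, residue_eq, add_sub_add_left_eq_sub, ← Finset.sum_sub_distrib, Finset.mul_sum]
    refine Finset.sum_congr rfl fun j _ => ?_
    simp only [he, Pi.one_apply, Units.val_one, a]; ring
  have h2 : residue p l ε + residue p l 1 = 2 * (bigP p + ∑ j, (1 - e j) * a j) := by
    rw [residue_eq, residue_eq, mul_add, Finset.mul_sum]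
    rw [show ∀ x y z : ℤ, x + y + (x + z) = 2 * x + (y + z) by intros; ring,
      ← Finset.sum_add_distrib]
    congr 1
    refine Finset.sum_congr rfl fun j _ => ?_
    simp only [he, Pi.one_apply, Units.val_one, a]; ring
  have h3 : (bigP p : ℤ) ∣ (∑ j, e j * a j) * ∑ j, (1 - e j) * a j := by
    rw [Finset.sum_mul_sum]
    refine Finset.dvd_sum fun j _ => Finset.dvd_sum fun k _ => ?_
    rcases eq_or_ne j k with rfl | h
    · rw [show e j * a j * ((1 - e j) * a j) = (e j * (1 - e j)) * a j ^ 2 by ring, hee]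
      simp
    · rw [show e j * a j * ((1 - e k) * a k)
        = (cof p j * cof p k) * (e j * (1 - e k) * l j * l k) by simp only [a]; ring]
      exact (bigP_dvd_cof_mul_cof hpos h).mul_right _
  obtain ⟨c, hc⟩ := h3
  refine ⟨-(∑ j, e j * a j) - c, ?_⟩
  rw [sq_sub_sq, h2, h1]
  linear_combination (-4) * hc

lemma sq_modEq_of_chi_ne_zero (hpos : ∀ j, 0 < p j) (l : Fin 4 → ℤ) {n : ℤ}
    (hn : chi p l n ≠ 0) : (4 * bigP p : ℤ) ∣ n ^ 2 - residue p l 1 ^ 2 := by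
  rw [chi_eq] at hn
  obtain ⟨ε, -, hε⟩ := Finset.exists_ne_zero_of_sum_ne_zero hn
  have hd : (2 * bigP p : ℤ) ∣ n - residue p l ε := by
    by_contra h; exact hε (if_neg h)
  obtain ⟨c, hc⟩ := hd
  have hn' : n = residue p l ε + 2 * bigP p * c := by linarith
  have h := residue_sq_modEq hpos l ε
  have : (4 * bigP p : ℤ) ∣ n ^ 2 - residue p l ε ^ 2 :=
    ⟨c * residue p l ε + bigP p * c ^ 2, by rw [hn']; ring⟩
  have := dvd_add this h
  rwa [sub_add_sub_cancel] at this

/-- The common value of `exp(2πi N n² / 4P)` on the support of `χ`. -/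
def phase (p : Fin 4 → ℕ) (l : Fin 4 → ℤ) (N : ℤ) : ℂ :=
  Complex.exp (2 * Real.pi * Complex.I * N * ((residue p l 1 : ℂ) ^ 2 / (4 * bigP p)))

lemma exp_eq_phase (hpos : ∀ j, 0 < p j) (l : Fin 4 → ℤ) (N : ℤ) {n : ℕ}
    (hn : chi p l n ≠ 0) :
    Complex.exp (2 * Real.pi * Complex.I * N * ((n : ℂ) ^ 2 / (4 * bigP p))) = phase p l N := by
  obtain ⟨c, hc⟩ := sq_modEq_of_chi_ne_zero hpos l hn
  have hP : (bigP p : ℂ) ≠ 0 := by exact_mod_cast (bigP_pos hpos).ne'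
  have hc' : (n : ℂ) ^ 2 - (residue p l 1 : ℂ) ^ 2 = 4 * bigP p * c := by exact_mod_cast hc
  rw [phase, Complex.exp_eq_exp_iff_exists_int]
  refine ⟨N * c, ?_⟩
  rw [show (n : ℂ) ^ 2 = (residue p l 1 : ℂ) ^ 2 + 4 * bigP p * c by linear_combination hc']
  push_cast
  field_simp

/-- The regularised sum `∑ n χ(n) exp(-a n²)`. -/
def chiSum (p : Fin 4 → ℕ) (l : Fin 4 → ℤ) (a : ℝ) : ℝ :=
  ∑' n : ℕ, (chi p l (n : ℤ) : ℝ) * gaussMoment a n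

/-- On the vertical line above an integer, the Eichler integral is a unimodular constant times a
real Gaussian sum. -/
lemma eichlerIntegral_vertical (hpos : ∀ j, 0 < p j) (l : Fin 4 → ℤ) (N : ℤ) {t : ℝ}
    (ht : 0 < t) :
    eichlerIntegral p l (UpperHalfPlane.ofComplex (((N : ℝ) : ℂ) + (t : ℂ) * Complex.I))
      = phase p l N * (chiSum p l (2 * Real.pi * t / (4 * bigP p)) : ℂ) := by
  have him : 0 < (((N : ℝ) : ℂ) + (t : ℂ) * Complex.I).im := by simpa using ht
  rw [UpperHalfPlane.ofComplex_apply_of_im_pos him, eichlerIntegral, chiSum, Complex.ofReal_tsum,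
    ← tsum_mul_left]
  refine tsum_congr fun n => ?_
  rcases eq_or_ne (chi p l n) 0 with h | h
  · simp [h]
  rw [← exp_eq_phase hpos l N h, gaussMoment]
  have hP : (bigP p : ℂ) ≠ 0 := by exact_mod_cast (bigP_pos hpos).ne'
  push_cast
  rw [show ∀ x y z w : ℂ, x * (y * (z * w)) = z * y * (x * w) by
    intros; ring, ← Complex.exp_add]
  congr 2
  field_simp
  linear_combination ((t : ℂ) * n ^ 2) * Complex.I_sq

lemma phase_ne_zero (p : Fin 4 → ℕ) (l : Fin 4 → ℤ) (N : ℤ) : phase p l N ≠ 0 :=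
  Complex.exp_ne_zero _

theorem hasLimitingValue_eichlerIntegral (hpos : ∀ j, 0 < p j) (l : Fin 4 → ℤ) (N : ℤ) :
    HasLimitingValue (eichlerIntegral p l) (N : ℝ) (phase p l N * (chiPot p l 0 : ℂ)) := by
  have hP : (0 : ℝ) < bigP p := by exact_mod_cast bigP_pos hpos
  have h1 : Tendsto (fun t : ℝ => 2 * Real.pi * t / (4 * bigP p)) (𝓝[>] 0)
      (𝓝[>] (0 : ℝ)) := by
    refine tendsto_nhdsWithin_iff.2 ⟨?_, ?_⟩
    · have : Continuous fun t : ℝ => 2 * Real.pi * t / (4 * bigP p) := by fun_prop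
      simpa using (this.tendsto (0 : ℝ)).mono_left nhdsWithin_le_nhds
    · filter_upwards [self_mem_nhdsWithin] with t ht
      have : 0 < t := ht
      rw [Set.mem_Ioi]
      positivity
  have h2 := (tendsto_tsum_chi_mul_gaussMoment hpos l).comp h1
  have h3 := ((Complex.continuous_ofReal.tendsto _).comp h2).const_mul (phase p l N)
  refine h3.congr' ?_
  filter_upwards [self_mem_nhdsWithin] with t ht
  exact (eichlerIntegral_vertical hpos l N ht).symm

lemma exists_limitingValue_ne_zero_iff (hpos : ∀ j, 0 < p j) (l : Fin 4 → ℤ) (N : ℤ) :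
    (∃ L : ℂ, L ≠ 0 ∧ HasLimitingValue (eichlerIntegral p l) (N : ℝ) L) ↔ chiPot p l 0 ≠ 0 := by
  have h := hasLimitingValue_eichlerIntegral hpos l N
  constructor
  · rintro ⟨L, hL, hL'⟩ h0
    rw [h0, Complex.ofReal_zero, mul_zero] at h
    exact hL (tendsto_nhds_unique hL' h)
  · intro h0
    exact ⟨_, mul_ne_zero (phase_ne_zero p l N) (by exact_mod_cast h0), h⟩

/-- Coefficients of a series `∑ n d(n) exp(-a n²)` with bounded `d` are determined by its values:
the first nonzero coefficient is seen as `a → ∞`. -/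
lemma coeff_eq_zero_of_tsum_gaussMoment_eq_zero {d : ℕ → ℝ} {C : ℝ} (hd : ∀ n, |d n| ≤ C)
    (h : ∀ a : ℝ, 0 < a → ∑' n : ℕ, d n * gaussMoment a n = 0) (n : ℕ) (hn : n ≠ 0) :
    d n = 0 := by
  induction n using Nat.strong_induction_on with
  | _ n ih =>
  have hC : 0 ≤ C := (abs_nonneg _).trans (hd 0)
  set F : ℝ → ℕ → ℝ := fun a k => Real.exp (a * n ^ 2) * (d k * gaussMoment a k) with hF
  have hFe : ∀ a k, F a k = d k * k * Real.exp (-(a * ((k : ℝ) ^ 2 - n ^ 2))) := fun a k => by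
    simp only [hF, gaussMoment]
    rw [show ∀ x y z w : ℝ, x * (y * (z * w)) = y * z * (x * w) by intros; ring,
      ← Real.exp_add]
    congr 2
    ring
  have hlt : ∀ a k, k < n → F a k = 0 := fun a k hk => by
    rw [hFe]
    rcases eq_or_ne k 0 with rfl | hk0
    · simp
    · rw [ih k hk hk0]; simp
  have hlim : Tendsto (fun a => ∑' k, F a k) atTop
      (𝓝 (∑' k, if k = n then d n * (n : ℝ) else 0)) := by
    refine tendsto_tsum_of_dominated_convergence
      (bound := fun k => C * (Real.exp (n ^ 2) * gaussMoment 1 k))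
      (((summable_gaussMoment one_pos).mul_left _).mul_left _) (fun k => ?_) ?_
    · rcases lt_trichotomy k n with hk | rfl | hk
      · simp only [hlt _ k hk, if_neg hk.ne]
        exact tendsto_const_nhds
      · simp [hFe]
      · rw [if_neg hk.ne']
        simp only [hFe]
        have hpos : (0 : ℝ) < (k : ℝ) ^ 2 - n ^ 2 := by
          have : (n : ℝ) < k := by exact_mod_cast hk
          have h0 : (0 : ℝ) ≤ n := by positivity
          nlinarith
        have := (Real.tendsto_exp_neg_atTop_nhds_zero.comp
          (tendsto_id.atTop_mul_const hpos)).const_mul (d k * (k : ℝ))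
        simpa using this
    · filter_upwards [eventually_ge_atTop 1] with a ha k
      rcases lt_or_ge k n with hk | hk
      · rw [hlt a k hk, norm_zero]
        unfold gaussMoment; positivity
      · rw [hFe, gaussMoment, norm_mul, norm_mul, Real.norm_eq_abs, Real.norm_eq_abs,
          Real.norm_eq_abs, Real.abs_exp, Nat.abs_cast, mul_assoc]
        have hk' : (n : ℝ) ^ 2 ≤ (k : ℝ) ^ 2 := by
          have : (n : ℝ) ≤ k := by exact_mod_cast hk
          gcongr
        refine mul_le_mul (hd k) ?_ (by positivity) hC
        rw [← mul_assoc, mul_comm (Real.exp _) (k : ℝ), mul_assoc, ← Real.exp_add]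
        refine mul_le_mul_of_nonneg_left (Real.exp_le_exp.2 ?_) (by positivity)
        nlinarith
  rw [tsum_ite_eq] at hlim
  have h0 : (fun a => ∑' k, F a k) =ᶠ[atTop] fun _ => 0 := by
    filter_upwards [eventually_gt_atTop 0] with a ha
    rw [hF]
    simp only [tsum_mul_left, h a ha, mul_zero]
  have := tendsto_nhds_unique (hlim.congr' h0) tendsto_const_nhds
  exact (mul_eq_zero.1 this).resolve_right (by exact_mod_cast hn)

theorem eichlerIntegral_eq_iff (hpos : ∀ j, 0 < p j) (l l' : Fin 4 → ℤ) :
    eichlerIntegral p l = eichlerIntegral p l' ↔ chi p l = chi p l' := by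
  refine ⟨fun h => ?_, fun h => by unfold eichlerIntegral; rw [h]⟩
  have hP := bigP_pos hpos
  have hP' : (0 : ℝ) < bigP p := by exact_mod_cast hP
  have hsum : ∀ a : ℝ, 0 < a → chiSum p l a = chiSum p l' a := fun a ha => by
    have ht : 0 < a * (4 * bigP p) / (2 * Real.pi) := by positivity
    have e1 := eichlerIntegral_vertical hpos l 0 ht
    have e2 := eichlerIntegral_vertical hpos l' 0 ht
    rw [show 2 * Real.pi * (a * (4 * bigP p) / (2 * Real.pi)) / (4 * bigP p) = a by
      field_simp] at e1 e2
    rw [h, e2] at e1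
    have hph : ∀ m, phase p m 0 = 1 := fun m => by simp [phase]
    rw [hph, hph, one_mul, one_mul] at e1
    exact_mod_cast e1.symm
  have key := coeff_eq_zero_of_tsum_gaussMoment_eq_zero
    (d := fun n => (chi p l (n : ℤ) : ℝ) - chi p l' (n : ℤ)) (C := 16 + 16)
    (fun n => (abs_sub _ _).trans (add_le_add (by exact_mod_cast abs_chi_le p l n)
      (by exact_mod_cast abs_chi_le p l' n)))
    (fun a ha => by
      simp only [sub_mul]
      rw [(summable_chi_mul_gaussMoment p l ha).tsum_sub (summable_chi_mul_gaussMoment p l' ha),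
        sub_eq_zero]
      exact hsum a ha)
  funext n
  -- move `n` to a positive representative of its class modulo `2P`
  obtain ⟨m, hm0, hm⟩ : ∃ m : ℕ, m ≠ 0 ∧ (m : ℤ) = n + ((|n| + 1 : ℤ)) * (2 * bigP p) := by
    have : 0 < n + (|n| + 1) * (2 * bigP p) := by
      have h1 : (1 : ℤ) ≤ bigP p := by exact_mod_cast hP
      have h2 := neg_abs_le n
      have h3 := abs_nonneg n
      nlinarith
    exact ⟨(n + (|n| + 1) * (2 * bigP p)).toNat, by omega, Int.toNat_of_nonneg this.le⟩
  have hk := key m hm0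
  simp only [sub_eq_zero, Int.cast_inj] at hk
  rw [hm] at hk
  have per : ∀ l, chi p l (n + (|n| + 1) * (2 * bigP p)) = chi p l n := fun l => by
    simpa using (chi_periodic p l).int_mul (|n| + 1) n
  rwa [per, per] at hk

/-! ### Even flips and the vanishing criterion -/

/-- The quadruple obtained from `ℓ` by replacing `ℓⱼ` with `pⱼ - ℓⱼ` wherever `εⱼ = -1`. -/
def flip (p : Fin 4 → ℕ) (ε : Fin 4 → ℤˣ) (l : Fin 4 → ℤ) : Fin 4 → ℤ :=
  fun j => if ε j = 1 then l j else p j - l j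

lemma flip_flip (p : Fin 4 → ℕ) (δ ε : Fin 4 → ℤˣ) (l : Fin 4 → ℤ) :
    flip p δ (flip p ε l) = flip p (δ * ε) l := by
  funext j
  rcases Int.units_eq_one_or (δ j) with h | h <;> rcases Int.units_eq_one_or (ε j) with h' | h' <;>
    simp [flip, h, h']

lemma Admissible.flip {l : Fin 4 → ℤ} (hl : Admissible p l) (ε : Fin 4 → ℤˣ) :
    Admissible p (flip p ε l) := fun j => by
  have := hl j
  unfold SeifertEichler.flip
  split_ifs <;> omega

lemma sgn_mul (δ ε : Fin 4 → ℤˣ) : sgn (δ * ε) = sgn δ * sgn ε := by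
  simp [sgn, Finset.prod_mul_distrib]

lemma two_dvd_sum_of_sgn_eq_one :
    ∀ ε η : Fin 4 → ℤˣ, sgn ε = 1 → (2 : ℤ) ∣ ∑ j, (η j : ℤ) * (if ε j = 1 then 0 else 1) := by
  intro ε η h
  have h' : sgn ε = 1 → (2 : ℤ) ∣ ∑ j, (if ε j = 1 then 0 else 1) := by
    revert ε; decide
  have h2 := h' h
  have : (2 : ℤ) ∣ ∑ j, (η j : ℤ) * (if ε j = 1 then 0 else 1)
      - ∑ j, (if ε j = 1 then (0 : ℤ) else 1) := by
    rw [← Finset.sum_sub_distrib]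
    refine Finset.dvd_sum fun j _ => ?_
    rcases Int.units_eq_one_or (η j) with h | h <;> simp only [h] <;> split_ifs <;> norm_num
  exact (dvd_sub_left h2).1 this

/-- Even flips do not change `χ`. -/
lemma chi_flip {ε : Fin 4 → ℤˣ} (hε : sgn ε = 1) (l : Fin 4 → ℤ) :
    chi p (flip p ε l) = chi p l := by
  funext n
  symm
  rw [chi_eq, ← Equiv.sum_comp (Equiv.mulRight ε), chi_eq]
  refine Finset.sum_congr rfl fun η _ => ?_
  obtain ⟨c, hc⟩ := two_dvd_sum_of_sgn_eq_one ε η hε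
  have hres : residue p (flip p ε l) η = residue p l (η * ε) + 2 * bigP p * c := by
    rw [residue_eq, residue_eq, add_assoc,
      show (2 : ℤ) * bigP p * c = bigP p * (2 * c) by ring, ← hc, Finset.mul_sum,
      ← Finset.sum_add_distrib]
    congr 1
    refine Finset.sum_congr rfl fun j _ => ?_
    rw [← mul_cof p j]
    rcases Int.units_eq_one_or (ε j) with h | h
    · simp [flip, h]
    · simp [flip, h]; ring
  simp only [Equiv.coe_mulRight, sgn_mul, hε, mul_one, hres]
  congr 1
  rw [eq_iff_iff, ← sub_sub]
  exact (dvd_sub_left (Dvd.intro _ rfl)).symm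

lemma dvd_residue_sub (hpos : ∀ j, 0 < p j) (l : Fin 4 → ℤ) (ε : Fin 4 → ℤˣ) (j : Fin 4) :
    (p j : ℤ) ∣ residue p l ε - (ε j : ℤ) * (l j * cof p j) := by
  rw [residue_eq, ← Finset.add_sum_erase _ _ (Finset.mem_univ j)]
  rw [show ∀ x y z : ℤ, x + (y + z) - y = x + z by intros; ring]
  refine dvd_add ⟨_, (mul_cof p j).symm⟩ (Finset.dvd_sum fun k hk => ?_)
  exact ((dvd_cof hpos (Finset.ne_of_mem_erase hk).symm).mul_left _).mul_left _

/-- Comparing residues modulo `pⱼ`. -/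
lemma dvd_of_residue_dvd (hpos : ∀ j, 0 < p j)
    (hcop : ∀ j k, j ≠ k → Nat.Coprime (p j) (p k)) {l l' : Fin 4 → ℤ} {ε ε' : Fin 4 → ℤˣ}
    (h : (2 * bigP p : ℤ) ∣ residue p l ε - residue p l' ε') (j : Fin 4) :
    (p j : ℤ) ∣ (ε j : ℤ) * l j - (ε' j : ℤ) * l' j := by
  have h1 : (p j : ℤ) ∣ residue p l ε - residue p l' ε' :=
    Dvd.dvd.trans ⟨2 * cof p j, by rw [← mul_cof p j]; ring⟩ h
  have h2 := dvd_sub (dvd_sub h1 (dvd_residue_sub hpos l ε j)) (dvd_neg.2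
    (dvd_residue_sub hpos l' ε' j))
  refine (isCoprime_cof hpos hcop j).dvd_of_dvd_mul_right ?_
  convert h2 using 1
  ring

/-- The sixteen residues are distinct modulo `2P`. If two of them agreed, every sign in which they
differ would have `2 ℓⱼ = pⱼ`; by coprimality there is only one such `j`, and then the residues
differ by `P`. -/
lemma residue_injective (hpos : ∀ j, 0 < p j)
    (hcop : ∀ j k, j ≠ k → Nat.Coprime (p j) (p k)) {l : Fin 4 → ℤ} (hl : Admissible p l)
    {ε ε' : Fin 4 → ℤˣ} (h : (2 * bigP p : ℤ) ∣ residue p l ε - residue p l ε') : ε = ε' := by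
  by_contra hne
  have hhalf : ∀ j, ε j ≠ ε' j → 2 * l j = p j := fun j hj => by
    have hd := dvd_of_residue_dvd hpos hcop h j
    have hlj := hl j
    have hd' : (p j : ℤ) ∣ 2 * l j := by
      rcases Int.units_eq_one_or (ε j) with h1 | h1 <;>
        rcases Int.units_eq_one_or (ε' j) with h2 | h2
      · exact absurd (h1.trans h2.symm) hj
      · rw [h1, h2] at hd
        refine hd.trans (dvd_of_eq ?_)
        simp only [Units.val_one, Units.val_neg]; ring
      · rw [h1, h2] at hd
        refine dvd_neg.1 (hd.trans (dvd_of_eq ?_))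
        simp only [Units.val_one, Units.val_neg]; ring
      · exact absurd (h1.trans h2.symm) hj
    obtain ⟨c, hc⟩ := hd'
    have hc0 : 0 < c := by
      by_contra hneg
      have : (p j : ℤ) * c ≤ 0 := mul_nonpos_of_nonneg_of_nonpos (by positivity) (by omega)
      omega
    have hc2 : c < 2 := by
      by_contra hge
      have : (p j : ℤ) * 2 ≤ p j * c := mul_le_mul_of_nonneg_left (by omega) (by positivity)
      omega
    have : c = 1 := by omega
    rw [hc, this, mul_one]
  obtain ⟨j, hj⟩ := Function.ne_iff.1 hne
  have huniq : ∀ k, k ≠ j → ε k = ε' k := fun k hk => by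
    by_contra hk'
    have h1 := hhalf j hj
    have h2 := hhalf k hk'
    have h3 : 2 ∣ Nat.gcd (p k) (p j) := Nat.dvd_gcd (by omega) (by omega)
    rw [hcop k j hk] at h3
    omega
  have hdiff : residue p l ε - residue p l ε' = ((ε j : ℤ) - ε' j) * (l j * cof p j) := by
    rw [residue_eq, residue_eq, add_sub_add_left_eq_sub, ← Finset.sum_sub_distrib,
      Finset.sum_eq_single j (fun k _ hk => by rw [huniq k hk]; ring)
        (fun h => absurd (Finset.mem_univ j) h)]
    ring
  have hP : (0 : ℤ) < bigP p := by exact_mod_cast bigP_pos hpos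
  have h2P : (2 * bigP p : ℤ) ∣ bigP p := by
    rw [hdiff] at h
    have e : (bigP p : ℤ) = 2 * (l j * cof p j) := by
      rw [← mul_cof p j, ← hhalf j hj]; ring
    have e' : ((ε j : ℤ) - ε' j) * (l j * cof p j) = bigP p ∨
        ((ε j : ℤ) - ε' j) * (l j * cof p j) = -bigP p := by
      rcases Int.units_eq_one_or (ε j) with h1 | h1 <;>
        rcases Int.units_eq_one_or (ε' j) with h2 | h2
      · exact absurd (h1.trans h2.symm) hj
      · left; rw [h1, h2, e]; simp only [Units.val_one, Units.val_neg]; ring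
      · right; rw [h1, h2, e]; simp only [Units.val_one, Units.val_neg]; ring
      · exact absurd (h1.trans h2.symm) hj
    rcases e' with e' | e'
    · rwa [e'] at h
    · rwa [e', dvd_neg] at h
  have := Int.le_of_dvd hP h2P
  omega

lemma chi_eq_of_dvd (hpos : ∀ j, 0 < p j)
    (hcop : ∀ j k, j ≠ k → Nat.Coprime (p j) (p k)) {l : Fin 4 → ℤ} (hl : Admissible p l)
    {ε : Fin 4 → ℤˣ} {n : ℤ} (h : (2 * bigP p : ℤ) ∣ n - residue p l ε) :
    chi p l n = -sgn ε := by
  rw [chi_eq, Finset.sum_eq_single ε (fun ε' _ hne => if_neg fun h' => hne ?_)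
    (fun h => absurd (Finset.mem_univ ε) h), if_pos h]
  refine residue_injective hpos hcop hl ?_
  have := dvd_sub h h'
  rwa [sub_sub_sub_cancel_left] at this

/-- `χ` determines `ℓ` up to even flips. -/
theorem chi_eq_chi_iff (hpos : ∀ j, 0 < p j)
    (hcop : ∀ j k, j ≠ k → Nat.Coprime (p j) (p k)) {l l' : Fin 4 → ℤ} (hl : Admissible p l)
    (hl' : Admissible p l') : chi p l' = chi p l ↔ ∃ ε, sgn ε = 1 ∧ l' = flip p ε l := by
  refine ⟨fun h => ?_, fun ⟨ε, hε, h⟩ => h ▸ chi_flip hε l⟩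
  have h1 : chi p l (residue p l' 1) = -1 := by
    rw [← h, chi_eq_of_dvd hpos hcop hl' (ε := 1) (by simp)]; simp [sgn]
  have hne : chi p l (residue p l' 1) ≠ 0 := by rw [h1]; decide
  rw [chi_eq] at hne
  obtain ⟨ε, -, hε⟩ := Finset.exists_ne_zero_of_sum_ne_zero hne
  have hd : (2 * bigP p : ℤ) ∣ residue p l' 1 - residue p l ε := by
    by_contra h; exact hε (if_neg h)
  rw [chi_eq_of_dvd hpos hcop hl hd] at h1
  refine ⟨ε, by omega, funext fun j => ?_⟩
  have hj := dvd_of_residue_dvd hpos hcop hd j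
  have a1 := hl j
  have a2 := hl' j
  rcases Int.units_eq_one_or (ε j) with e | e
  · have := Int.eq_zero_of_abs_lt_dvd (x := l' j - l j) (by simpa [e] using hj)
      (by rw [abs_lt]; omega)
    simp only [flip, e, if_true]; omega
  · have h3 : (p j : ℤ) ∣ l' j + l j - p j := by
      have := dvd_sub_self_right.2 (show (p j : ℤ) ∣ l' j + l j by simpa [e] using hj)
      exact this
    have := Int.eq_zero_of_abs_lt_dvd h3 (by rw [abs_lt]; omega)
    simp only [flip, e]
    rw [if_neg (by decide)]; omega

/-- `∑ⱼ ℓⱼ P / pⱼ`, that is `P ∑ⱼ ℓⱼ / pⱼ`. -/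
def height (p : Fin 4 → ℕ) (l : Fin 4 → ℤ) : ℤ := ∑ j, l j * cof p j

lemma cof_pos (hpos : ∀ j, 0 < p j) (j : Fin 4) : 0 < cof p j := by
  rw [cof_eq_prod_erase hpos]
  exact Finset.prod_pos fun k _ => by exact_mod_cast hpos k

lemma not_dvd_mul_cof (hpos : ∀ j, 0 < p j)
    (hcop : ∀ j k, j ≠ k → Nat.Coprime (p j) (p k)) {l : Fin 4 → ℤ} (hl : Admissible p l)
    (j : Fin 4) : ¬ (p j : ℤ) ∣ l j * cof p j := fun h => by
  have h1 := (isCoprime_cof hpos hcop j).dvd_of_dvd_mul_right h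
  have := Int.le_of_dvd (hl j).1 h1
  have := (hl j).2
  omega

/-- No proportion `∑ⱼ ℓⱼ / pⱼ` is an integer. -/
lemma not_bigP_dvd_height (hpos : ∀ j, 0 < p j)
    (hcop : ∀ j k, j ≠ k → Nat.Coprime (p j) (p k)) {l : Fin 4 → ℤ} (hl : Admissible p l) :
    ¬ (bigP p : ℤ) ∣ height p l := fun h => by
  refine not_dvd_mul_cof hpos hcop hl 0 ?_
  have h1 : (p 0 : ℤ) ∣ height p l := Dvd.dvd.trans ⟨_, (mul_cof p 0).symm⟩ h
  rw [height, ← Finset.add_sum_erase _ _ (Finset.mem_univ 0)] at h1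
  refine (Int.dvd_add_left (Finset.dvd_sum fun k hk => ?_)).1 h1
  exact (dvd_cof hpos (Finset.ne_of_mem_erase hk).symm).mul_left _

lemma pair_ne_bigP (hpos : ∀ j, 0 < p j)
    (hcop : ∀ j k, j ≠ k → Nat.Coprime (p j) (p k)) {l : Fin 4 → ℤ} (hl : Admissible p l)
    {i j : Fin 4} (hij : i ≠ j) : l i * cof p i + l j * cof p j ≠ bigP p := fun h => by
  refine not_dvd_mul_cof hpos hcop hl i ?_
  have h1 : (p i : ℤ) ∣ l i * cof p i + l j * cof p j := h ▸ ⟨_, (mul_cof p i).symm⟩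
  exact (Int.dvd_add_left ((dvd_cof hpos hij).mul_left _)).1 h1

lemma bernoulliPot_neg_add {P : ℕ} (hP : 0 < P) {s : ℤ} (h1 : -(3 * P) ≤ s) (h2 : s ≤ 3 * P) :
    bernoulliPot (2 * P) (0 - (P + s))
      = ((P : ℝ) ^ 2 - (s : ℝ) ^ 2) / (4 * P) + max (|(s : ℝ)| - P) 0 := by
  have hper := bernoulliPot_periodic (2 * P)
  have hP' : (P : ℝ) ≠ 0 := by positivity
  have hP0 : (0 : ℝ) < P := by positivity
  rcases lt_or_ge s (-P) with h | h
  · have hs : (s : ℝ) < -P := by exact_mod_cast h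
    rw [bernoulliPot_of_range (by omega) (by push_cast; omega), abs_of_neg (by linarith),
      max_eq_left (by linarith)]
    push_cast; field_simp; ring
  rcases le_or_gt s P with h' | h'
  · have hs : (s : ℝ) ≤ P := by exact_mod_cast h'
    have hs' : -(P : ℝ) ≤ s := by exact_mod_cast h
    rw [← hper, bernoulliPot_of_range (by push_cast; omega) (by push_cast; omega),
      max_eq_right (by linarith [abs_le.2 ⟨hs', hs⟩])]
    push_cast; field_simp; ring
  · have hs : (P : ℝ) < s := by exact_mod_cast h'
    rw [← hper, ← hper, bernoulliPot_of_range (by push_cast; omega) (by push_cast; omega),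
      abs_of_pos (by linarith), max_eq_left (by linarith)]
    push_cast; field_simp; ring

/-- The alternating sum over signs of a quadratic function vanishes; what remains are the
contributions of the sums exceeding `P` in absolute value. -/
lemma signed_sum_eq (P : ℝ) (v : Fin 4 → ℝ) (hv : ∀ j, 0 < v j)
    (hpair : ∀ i j, i ≠ j → v i + v j < P) :
    ∑ ε : Fin 4 → ℤˣ, (sgn ε : ℝ) * ((P ^ 2 - (∑ j, ((ε j : ℤ) : ℝ) * v j) ^ 2) / (4 * P)
        + max (|∑ j, ((ε j : ℤ) : ℝ) * v j| - P) 0)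
      = 2 * (max (∑ j, v j - P) 0 - ∑ i, max (∑ j, v j - 2 * v i - P) 0) := by
  have h01 := hpair 0 1 (by decide)
  have h02 := hpair 0 2 (by decide)
  have h03 := hpair 0 3 (by decide)
  have h12 := hpair 1 2 (by decide)
  have h13 := hpair 1 3 (by decide)
  have h23 := hpair 2 3 (by decide)
  have v0 := hv 0
  have v1 := hv 1
  have v2 := hv 2
  have v3 := hv 3
  generalize hw : (fun s : ℝ => max (|s| - P) 0) = w
  have hw' : ∀ s, max (|s| - P) 0 = w s := fun s => by rw [← hw]
  have hneg : ∀ s, w (-s) = w s := fun s => by rw [← hw]; simp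
  have hbig : ∀ s, -P < s → w s = max (s - P) 0 := fun s hs => by
    rw [← hw]
    rcases le_or_gt 0 s with h | h
    · simp only [abs_of_nonneg h]
    · simp only [abs_of_neg h]
      rw [max_eq_right (by linarith), max_eq_right (by linarith)]
  have hsmall : ∀ s, -P < s → s < P → w s = 0 := fun s h1 h2 => by
    rw [hbig s h1, max_eq_right (by linarith)]
  simp only [hw']
  rw [sum_signs]
  simp only [sum_unitsInt, sgn, Fin.prod_univ_four, Fin.sum_univ_four, Matrix.cons_val_zero,
    Matrix.cons_val_one, Matrix.cons_val]
  generalize v 0 = a at *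
  generalize v 1 = b at *
  generalize v 2 = c at *
  generalize v 3 = d at *
  push_cast
  simp only [one_mul, neg_mul]
  have e1 : w (-a + -b + -c + -d) = w (a + b + c + d) := by rw [← hneg]; congr 1; ring
  have e2 : w (a + -b + -c + -d) = w (-a + b + c + d) := by rw [← hneg]; congr 1; ring
  have e3 : w (-a + b + -c + -d) = w (a + -b + c + d) := by rw [← hneg]; congr 1; ring
  have e4 : w (-a + -b + c + -d) = w (a + b + -c + d) := by rw [← hneg]; congr 1; ring
  have e5 : w (-a + -b + -c + d) = w (a + b + c + -d) := by rw [← hneg]; congr 1; ring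
  rw [e1, e2, e3, e4, e5, hsmall (a + b + -c + -d) (by linarith) (by linarith),
    hsmall (a + -b + c + -d) (by linarith) (by linarith),
    hsmall (a + -b + -c + d) (by linarith) (by linarith),
    hsmall (-a + b + c + -d) (by linarith) (by linarith),
    hsmall (-a + b + -c + d) (by linarith) (by linarith),
    hsmall (-a + -b + c + d) (by linarith) (by linarith),
    hbig (a + b + c + d) (by linarith), hbig (-a + b + c + d) (by linarith),
    hbig (a + -b + c + d) (by linarith), hbig (a + b + -c + d) (by linarith),
    hbig (a + b + c + -d) (by linarith)]
  rw [show a + b + c + d - 2 * a - P = -a + b + c + d - P by ring,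
    show a + b + c + d - 2 * b - P = a + -b + c + d - P by ring,
    show a + b + c + d - 2 * c - P = a + b + -c + d - P by ring,
    show a + b + c + d - 2 * d - P = a + b + c + -d - P by ring]
  ring

/-- With `t = ∑ vⱼ`, the expression is `t - P`, `2 vᵢ`, `P - t + 2 vᵢ + 2 vⱼ`,
`2 (P - vᵢ)` or `3 P - t`, according to the number of indices with `t - 2 vᵢ > P`; each of these
is positive. In the fourth case `i` is the index with `t - 2 vᵢ ≤ P`, in the second the one with
`t - 2 vᵢ > P`. -/
lemma max_sub_sum_max_pos (P : ℝ) (v : Fin 4 → ℝ) (hv : ∀ j, 0 < v j)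
    (hpair : ∀ i j, i ≠ j → v i + v j < P) (ht : P < ∑ j, v j) :
    0 < max (∑ j, v j - P) 0 - ∑ i, max (∑ j, v j - 2 * v i - P) 0 := by
  have h01 := hpair 0 1 (by decide)
  have h02 := hpair 0 2 (by decide)
  have h03 := hpair 0 3 (by decide)
  have h12 := hpair 1 2 (by decide)
  have h13 := hpair 1 3 (by decide)
  have h23 := hpair 2 3 (by decide)
  have v0 := hv 0
  have v1 := hv 1
  have v2 := hv 2
  have v3 := hv 3
  rw [max_eq_left (by linarith)]
  simp only [Fin.sum_univ_four] at *
  rcases max_cases (v 0 + v 1 + v 2 + v 3 - 2 * v 0 - P) 0 with h | h <;>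
  rcases max_cases (v 0 + v 1 + v 2 + v 3 - 2 * v 1 - P) 0 with h' | h' <;>
  rcases max_cases (v 0 + v 1 + v 2 + v 3 - 2 * v 2 - P) 0 with h'' | h'' <;>
  rcases max_cases (v 0 + v 1 + v 2 + v 3 - 2 * v 3 - P) 0 with h''' | h''' <;>
  rw [h.1, h'.1, h''.1, h'''.1] <;> linarith

/-- When all pair sums `ℓᵢ / pᵢ + ℓⱼ / pⱼ` are below `1`, the limiting value vanishes exactly when
`∑ⱼ ℓⱼ / pⱼ < 1`. -/
lemma chiPot_eq_zero_iff_of_pair_lt (hpos : ∀ j, 0 < p j)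
    (hcop : ∀ j k, j ≠ k → Nat.Coprime (p j) (p k)) {l : Fin 4 → ℤ} (hl : Admissible p l)
    (hpair : ∀ i j, i ≠ j → l i * cof p i + l j * cof p j < bigP p) :
    chiPot p l 0 = 0 ↔ height p l < bigP p := by
  have hP := bigP_pos hpos
  have hapos : ∀ j, 0 < l j * cof p j := fun j => mul_pos (hl j).1 (cof_pos hpos j)
  set v : Fin 4 → ℝ := fun j => ((l j * cof p j : ℤ) : ℝ) with hv
  have hvpos : ∀ j, 0 < v j := fun j => Int.cast_pos.2 (hapos j)
  have hvpair : ∀ i j, i ≠ j → v i + v j < (bigP p : ℝ) := fun i j h => by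
    have := hpair i j h
    simp only [v]
    exact_mod_cast this
  have hsum : ∑ j, v j = (height p l : ℝ) := by simp [height, v]
  have hbound : ∀ ε : Fin 4 → ℤˣ, |∑ j, (ε j : ℤ) * (l j * cof p j)| ≤ 3 * bigP p := fun ε => by
    refine (Finset.abs_sum_le_sum_abs _ _).trans ?_
    have : ∀ j, |(ε j : ℤ) * (l j * cof p j)| = l j * cof p j := fun j => by
      rw [abs_mul, abs_of_pos (hapos j)]
      rcases Int.units_eq_one_or (ε j) with h | h <;> simp [h]
    simp only [this, Fin.sum_univ_four]
    have := hpair 0 1 (by decide)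
    have := hpair 2 3 (by decide)
    omega
  have hchi : chiPot p l 0 = -(2 * (max (∑ j, v j - bigP p) 0
      - ∑ i, max (∑ j, v j - 2 * v i - bigP p) 0)) := by
    rw [← signed_sum_eq (bigP p : ℝ) v hvpos hvpair, chiPot, ← Finset.sum_neg_distrib]
    refine Finset.sum_congr rfl fun ε _ => ?_
    have hb := abs_le.1 (hbound ε)
    rw [residue_eq, bernoulliPot_neg_add hP hb.1 hb.2]
    push_cast
    simp only [v]
    push_cast
    ring
  rw [hchi]
  have hne : height p l ≠ bigP p := fun h => not_bigP_dvd_height hpos hcop hl (h ▸ dvd_rfl)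
  constructor
  · intro h0
    by_contra hge
    have hlt : (bigP p : ℤ) < height p l := by omega
    have := max_sub_sum_max_pos (bigP p : ℝ) v hvpos hvpair (by rw [hsum]; exact_mod_cast hlt)
    linarith
  · intro hlt
    have hlt' : ∑ j, v j < bigP p := by rw [hsum]; exact_mod_cast hlt
    rw [max_eq_right (by linarith), Finset.sum_eq_zero fun i _ => ?_]
    · simp
    · exact max_eq_right (by linarith [hvpos i])

lemma pair_le_height (hpos : ∀ j, 0 < p j) {l : Fin 4 → ℤ} (hl : Admissible p l) {i j : Fin 4}
    (hij : i ≠ j) : l i * cof p i + l j * cof p j ≤ height p l := by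
  rw [height, ← Finset.sum_pair hij (f := fun j => l j * cof p j)]
  exact Finset.sum_le_sum_of_subset_of_nonneg (Finset.subset_univ _)
    fun k _ _ => (mul_pos (hl k).1 (cof_pos hpos k)).le

lemma chiPot_eq_of_chi_eq (hpos : ∀ j, 0 < p j) {l l' : Fin 4 → ℤ} (h : chi p l = chi p l') :
    chiPot p l 0 = chiPot p l' 0 := by
  have h1 := tendsto_tsum_chi_mul_gaussMoment hpos l
  rw [h] at h1
  exact tendsto_nhds_unique h1 (tendsto_tsum_chi_mul_gaussMoment hpos l')

/-- The limiting value vanishes exactly when some even flip of `ℓ` lies in the tetrahedron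
`∑ⱼ ℓⱼ / pⱼ < 1`: a flip of least height has all pair sums below `1`. -/
theorem chiPot_eq_zero_iff (hpos : ∀ j, 0 < p j)
    (hcop : ∀ j k, j ≠ k → Nat.Coprime (p j) (p k)) {l : Fin 4 → ℤ} (hl : Admissible p l) :
    chiPot p l 0 = 0 ↔ ∃ ε, sgn ε = 1 ∧ height p (flip p ε l) < bigP p := by
  constructor
  · intro h0
    obtain ⟨ε, hε, hmin⟩ := Finset.exists_min_image
      (Finset.univ.filter fun ε : Fin 4 → ℤˣ => sgn ε = 1) (fun ε => height p (flip p ε l))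
      ⟨1, Finset.mem_filter.2 ⟨Finset.mem_univ _, by simp [sgn]⟩⟩
    rw [Finset.mem_filter] at hε
    have hl' := hl.flip ε
    refine ⟨ε, hε.2, ?_⟩
    rw [← chiPot_eq_of_chi_eq hpos (chi_flip hε.2 l)] at h0
    refine (chiPot_eq_zero_iff_of_pair_lt hpos hcop hl' fun i j hij => ?_).1 h0
    refine lt_of_le_of_ne ?_ (pair_ne_bigP hpos hcop hl' hij)
    set δ : Fin 4 → ℤˣ := fun k => if k = i ∨ k = j then -1 else 1 with hδ
    have hsδ : sgn δ = 1 := by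
      clear_value δ
      subst hδ
      revert i j; decide
    have h1 := hmin (δ * ε) (by simp [sgn_mul, hsδ, hε.2])
    rw [← flip_flip] at h1
    generalize flip p ε l = m at *
    have h2 : height p (flip p δ m) - height p m
        = (p i * cof p i - 2 * (m i * cof p i)) + (p j * cof p j - 2 * (m j * cof p j)) := by
      rw [height, height, ← Finset.sum_sub_distrib,
        ← Finset.sum_pair hij (f := fun k => (p k * cof p k - 2 * (m k * cof p k) : ℤ))]
      symm
      refine Finset.sum_subset_zero_on_sdiff (Finset.subset_univ _) (fun k hk => ?_)
        (fun k hk => ?_)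
      · have : ¬ (k = i ∨ k = j) := by simpa using hk
        simp [flip, δ, this]
      · have : k = i ∨ k = j := by simpa using hk
        simp [flip, δ, this]; ring
    rw [mul_cof, mul_cof] at h2
    omega
  · rintro ⟨ε, hε, h⟩
    rw [← chiPot_eq_of_chi_eq hpos (chi_flip hε l)]
    exact (chiPot_eq_zero_iff_of_pair_lt hpos hcop (hl.flip ε) fun i j hij =>
      (pair_le_height hpos (hl.flip ε) hij).trans_lt h).2 h

lemma exists_pair_of_sgn_eq_one :
    ∀ ε : Fin 4 → ℤˣ, sgn ε = 1 → ε ≠ 1 → ∃ i j, i ≠ j ∧ ε i = -1 ∧ ε j = -1 := by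
  decide

/-- At most one even flip of `ℓ` lies in the tetrahedron. -/
lemma eq_one_of_height_flip_lt (hpos : ∀ j, 0 < p j) {l : Fin 4 → ℤ} (hl : Admissible p l)
    {ε : Fin 4 → ℤˣ} (hε : sgn ε = 1) (h : height p l < bigP p)
    (h' : height p (flip p ε l) < bigP p) : ε = 1 := by
  by_contra hne
  obtain ⟨i, j, hij, hi, hj⟩ := exists_pair_of_sgn_eq_one ε hε hne
  have h1 := pair_le_height hpos hl hij
  have h2 := pair_le_height hpos (hl.flip ε) hij
  simp only [flip, hi, hj] at h2
  rw [if_neg (by decide), if_neg (by decide), sub_mul, sub_mul, mul_cof, mul_cof] at h2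
  omega

/-! ### Counting orbits -/

/-- The finite set of admissible quadruples. -/
def admSet (p : Fin 4 → ℕ) : Finset (Fin 4 → ℤ) :=
  Fintype.piFinset fun j => Finset.Ioo 0 (p j : ℤ)

lemma mem_admSet {l : Fin 4 → ℤ} : l ∈ admSet p ↔ Admissible p l := by
  simp [admSet, Admissible]

lemma card_admSet (hpos : ∀ j, 0 < p j) : ((admSet p).card : ℝ) = ∏ j, ((p j : ℝ) - 1) := by
  rw [admSet, Fintype.card_piFinset, Nat.cast_prod]
  refine Finset.prod_congr rfl fun j _ => ?_
  rw [Int.card_Ioo, sub_zero]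
  have := hpos j
  rw [show ((p j : ℤ) - 1).toNat = p j - 1 by omega, Nat.cast_sub this, Nat.cast_one]

/-- The group of even sign patterns. -/
def evenSigns : Finset (Fin 4 → ℤˣ) := Finset.univ.filter fun ε => sgn ε = 1

lemma card_evenSigns : evenSigns.card = 8 := by decide

lemma mem_evenSigns {ε : Fin 4 → ℤˣ} : ε ∈ evenSigns ↔ sgn ε = 1 := by simp [evenSigns]

lemma signs_mul_self (ε : Fin 4 → ℤˣ) : ε * ε = 1 := by
  funext j; exact Int.units_mul_self (ε j)

lemma eq_of_signs_mul_eq_one {δ ε : Fin 4 → ℤˣ} (h : δ * ε = 1) : δ = ε := by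
  rw [← mul_one δ, ← signs_mul_self ε, ← mul_assoc, h, one_mul]

lemma flip_one (l : Fin 4 → ℤ) : flip p 1 l = l := by
  funext j; simp [flip]

lemma flip_flip_self (ε : Fin 4 → ℤˣ) (l : Fin 4 → ℤ) : flip p ε (flip p ε l) = l := by
  rw [flip_flip, signs_mul_self, flip_one]

/-- Even flips act freely. -/
lemma flip_injOn (hcop : ∀ j k, j ≠ k → Nat.Coprime (p j) (p k)) (l : Fin 4 → ℤ) :
    Set.InjOn (fun ε => flip p ε l) evenSigns := by
  intro ε hε ε' hε' h
  have hε := mem_evenSigns.1 hε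
  have hε' := mem_evenSigns.1 hε'
  have hfix : flip p (ε * ε') l = l := by
    rw [← flip_flip]
    show flip p ε ((fun ε => flip p ε l) ε') = l
    rw [← h]
    exact flip_flip_self ε l
  by_contra hne
  obtain ⟨i, j, hij, hi, hj⟩ := exists_pair_of_sgn_eq_one (ε * ε')
    (by rw [sgn_mul, hε, hε', one_mul]) (fun h1 => hne (eq_of_signs_mul_eq_one h1))
  have e1 := congrFun hfix i
  have e2 := congrFun hfix j
  simp only [flip, hi, hj] at e1 e2
  rw [if_neg (by decide)] at e1 e2
  have h3 : 2 ∣ Nat.gcd (p i) (p j) := Nat.dvd_gcd (by omega) (by omega)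
  rw [hcop i j hij] at h3
  omega

/-- Each Eichler integral comes from exactly eight quadruples, an orbit of the even flips. -/
theorem eight_mul_gammaCount (hpos : ∀ j, 0 < p j)
    (hcop : ∀ j k, j ≠ k → Nat.Coprime (p j) (p k)) (N : ℤ) :
    8 * gammaCount p N = ((admSet p).filter fun l => chiPot p l 0 ≠ 0).card := by
  classical
  set good := (admSet p).filter fun l => chiPot p l 0 ≠ 0 with hgood
  have hset : {f : UpperHalfPlane → ℂ |
      (∃ l : Fin 4 → ℤ, Admissible p l ∧ f = eichlerIntegral p l) ∧
      ∃ L : ℂ, L ≠ 0 ∧ HasLimitingValue f (N : ℝ) L}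
      = ((good.image (eichlerIntegral p) : Finset _) : Set (UpperHalfPlane → ℂ)) := by
    ext f
    simp only [Set.mem_ofPred_eq, Finset.coe_image, Set.mem_image, Finset.mem_coe, hgood,
      Finset.mem_filter, mem_admSet]
    constructor
    · rintro ⟨⟨l, hl, rfl⟩, hL⟩
      exact ⟨l, ⟨hl, (exists_limitingValue_ne_zero_iff hpos l N).1 hL⟩, rfl⟩
    · rintro ⟨l, ⟨hl, h0⟩, rfl⟩
      exact ⟨⟨l, hl, rfl⟩, (exists_limitingValue_ne_zero_iff hpos l N).2 h0⟩
  rw [gammaCount, hset, Set.ncard_coe_finset,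
    Finset.card_eq_sum_card_image (eichlerIntegral p) good, Finset.sum_const_nat, mul_comm]
  intro f hf
  obtain ⟨l, hl, rfl⟩ := Finset.mem_image.1 hf
  rw [hgood, Finset.mem_filter, mem_admSet] at hl
  rw [← card_evenSigns, ← Finset.card_image_of_injOn (flip_injOn hcop l)]
  congr 1
  ext l'
  simp only [Finset.mem_filter, Finset.mem_image, hgood, mem_admSet, mem_evenSigns,
    eichlerIntegral_eq_iff hpos]
  constructor
  · rintro ⟨⟨hl', -⟩, h⟩
    obtain ⟨ε, hε, rfl⟩ := (chi_eq_chi_iff hpos hcop hl.1 hl').1 h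
    exact ⟨ε, hε, rfl⟩
  · rintro ⟨ε, hε, rfl⟩
    refine ⟨⟨hl.1.flip ε, ?_⟩, chi_flip hε l⟩
    rw [chiPot_eq_of_chi_eq hpos (chi_flip hε l)]
    exact hl.2

/-- The lattice points of the open tetrahedron `0 < ∑ⱼ ℓⱼ / pⱼ < 1`, `ℓⱼ > 0`. -/
def tetra (p : Fin 4 → ℕ) : Finset (Fin 4 → ℤ) :=
  (admSet p).filter fun l => height p l < bigP p

/-- The quadruples with vanishing limiting value are the even flips of the lattice points of the
tetrahedron, each obtained once. -/
theorem card_chiPot_eq_zero (hpos : ∀ j, 0 < p j)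
    (hcop : ∀ j k, j ≠ k → Nat.Coprime (p j) (p k)) :
    ((admSet p).filter fun l => chiPot p l 0 = 0).card = 8 * (tetra p).card := by
  classical
  have h1 : ∀ l ∈ admSet p, (if chiPot p l 0 = 0 then 1 else 0)
      = ∑ ε ∈ evenSigns, if height p (flip p ε l) < bigP p then 1 else 0 := fun l hl => by
    have hl' := mem_admSet.1 hl
    simp only [chiPot_eq_zero_iff hpos hcop hl']
    split_ifs with h
    · obtain ⟨ε, hε, hlt⟩ := h
      rw [Finset.sum_eq_single_of_mem ε (mem_evenSigns.2 hε), if_pos hlt]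
      intro ε' hε' hne
      rw [if_neg fun hlt' => hne ?_]
      refine eq_of_signs_mul_eq_one (eq_one_of_height_flip_lt hpos (hl'.flip ε) ?_ hlt ?_)
      · rw [sgn_mul, mem_evenSigns.1 hε', hε, one_mul]
      · rwa [flip_flip, mul_assoc, signs_mul_self, mul_one]
    · refine (Finset.sum_eq_zero fun ε hε => if_neg fun hlt => h ⟨ε, mem_evenSigns.1 hε, hlt⟩).symm
  have h2 : ∀ ε ∈ evenSigns, ∑ l ∈ admSet p, (if height p (flip p ε l) < bigP p then 1 else 0)
      = (tetra p).card := fun ε _ => by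
    rw [tetra, Finset.card_filter]
    refine Finset.sum_nbij' (flip p ε) (flip p ε) ?_ ?_ ?_ ?_ ?_
    · exact fun l hl => mem_admSet.2 ((mem_admSet.1 hl).flip ε)
    · exact fun l hl => mem_admSet.2 ((mem_admSet.1 hl).flip ε)
    · exact fun l _ => flip_flip_self ε l
    · exact fun l _ => flip_flip_self ε l
    · exact fun l _ => rfl
  rw [Finset.card_filter, Finset.sum_congr rfl h1, Finset.sum_comm, Finset.sum_const_nat h2,
    card_evenSigns]

theorem gammaCount_eq (hpos : ∀ j, 0 < p j)
    (hcop : ∀ j k, j ≠ k → Nat.Coprime (p j) (p k)) (N : ℤ) :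
    (gammaCount p N : ℝ) = (∏ j, ((p j : ℝ) - 1)) / 8 - (tetra p).card := by
  classical
  have h1 := eight_mul_gammaCount hpos hcop N
  have h2 := card_chiPot_eq_zero hpos hcop
  have h3 := Finset.card_filter_add_card_filter_not (s := admSet p)
    (fun l => chiPot p l 0 = 0)
  have h4 : 8 * (tetra p).card + 8 * gammaCount p N = (admSet p).card := by
    rw [h1, ← h2]; exact h3
  rw [← card_admSet hpos, ← h4]
  push_cast
  ring

/-! ### The sawtooth function and its distribution relation -/

lemma sawtooth_eq_fract (x : ℝ) : sawtooth x = (Int.fract x - Int.fract (-x)) / 2 := by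
  unfold sawtooth
  split_ifs with h
  · obtain ⟨m, rfl⟩ := h
    rw [← Int.cast_neg, Int.fract_intCast, Int.fract_intCast]; simp
  · have : Int.fract x ≠ 0 := fun h0 => h ⟨⌊x⌋, by
      have := Int.self_sub_floor x; rw [h0] at this; linarith⟩
    rw [Int.fract_neg this, ← Int.self_sub_floor]
    ring

lemma sawtooth_int (m : ℤ) : sawtooth m = 0 := by
  unfold sawtooth; exact if_pos ⟨m, rfl⟩

lemma sawtooth_zero : sawtooth 0 = 0 := by simpa using sawtooth_int 0

lemma sawtooth_periodic : Function.Periodic sawtooth 1 := fun x => by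
  rw [sawtooth_eq_fract, sawtooth_eq_fract, neg_add]
  have : -x + -1 = -x - ((1 : ℤ) : ℝ) := by push_cast; ring
  rw [this, Int.fract_sub_intCast, Int.fract_add_one]

lemma sawtooth_of_between {x : ℝ} {k : ℤ} (h1 : (k : ℝ) < x) (h2 : x < k + 1) :
    sawtooth x = x - k - 1 / 2 := by
  have hk : ⌊x⌋ = k := Int.floor_eq_iff.2 ⟨h1.le, h2⟩
  unfold sawtooth
  rw [if_neg, hk]
  rintro ⟨m, rfl⟩
  have h1' : k < m := by exact_mod_cast h1
  have h2' : m < k + 1 := by exact_mod_cast h2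
  omega

/-- The operator taking `f` to `y ↦ ∑_{a mod n} f(y + a / n)`; on functions of period `1`, operators
for coprime moduli compose to the one for the product. -/
def periodSum (n : ℕ) : (ℝ → ℝ) →ₗ[ℝ] (ℝ → ℝ) where
  toFun f y := ∑ a ∈ Finset.Ico (0 : ℤ) n, f (y + a / n)
  map_add' f g := by funext y; simp [Finset.sum_add_distrib]
  map_smul' c f := by funext y; simp [Finset.mul_sum]

/-- The operator `periodSum` without the term of `a = 0`. -/
def puncturedSum (n : ℕ) (f : ℝ → ℝ) (y : ℝ) : ℝ := ∑ a ∈ Finset.Ioo (0 : ℤ) n, f (y + a / n)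

lemma puncturedSum_eq {n : ℕ} (hn : 0 < n) (f : ℝ → ℝ) :
    puncturedSum n f = periodSum n f - f := by
  funext y
  have h : Finset.Ico (0 : ℤ) n = insert 0 (Finset.Ioo 0 (n : ℤ)) :=
    (Finset.Ioo_insert_left (by exact_mod_cast hn)).symm
  show ∑ a ∈ Finset.Ioo (0 : ℤ) n, f (y + a / n) = ∑ a ∈ Finset.Ico (0 : ℤ) n, f (y + a / n) - f y
  rw [h, Finset.sum_insert (by simp)]
  simp

lemma sum_Ico_int (n : ℕ) (g : ℤ → ℝ) :
    ∑ a ∈ Finset.Ico (0 : ℤ) n, g a = ∑ k ∈ Finset.range n, g (k : ℤ) := by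
  refine (Finset.sum_nbij' (fun k : ℕ => (k : ℤ)) Int.toNat ?_ ?_ ?_ ?_ ?_).symm
  · intro k hk; simpa using hk
  · intro a ha; rw [Finset.mem_Ico] at ha; rw [Finset.mem_range]; omega
  · intro k _; simp
  · intro a ha; rw [Finset.mem_Ico] at ha; exact Int.toNat_of_nonneg ha.1
  · intro k _; rfl

lemma periodic_div {f : ℝ → ℝ} (hf : Function.Periodic f 1) {n : ℕ} (hn : 0 < n) (y : ℝ) :
    Function.Periodic (fun a : ℤ => f (y + a / n)) (n : ℤ) := fun a => by
  have : (n : ℝ) ≠ 0 := by positivity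
  show f (y + ((a + n : ℤ) : ℝ) / n) = f (y + a / n)
  rw [← hf (y + a / n)]
  congr 1
  push_cast; field_simp; ring

lemma periodSum_periodSum {f : ℝ → ℝ} (hf : Function.Periodic f 1) {m n : ℕ} (hm : 0 < m)
    (hn : 0 < n) (h : Nat.Coprime m n) : periodSum m (periodSum n f) = periodSum (m * n) f := by
  funext y
  have hm' : (m : ℝ) ≠ 0 := by positivity
  have hn' : (n : ℝ) ≠ 0 := by positivity
  have hmn : IsCoprime (m : ℤ) n := Nat.isCoprime_iff_coprime.2 h
  show ∑ a ∈ Finset.Ico (0 : ℤ) m, ∑ b ∈ Finset.Ico (0 : ℤ) n, f (y + a / m + b / n)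
    = ∑ a ∈ Finset.Ico (0 : ℤ) (m * n : ℕ), f (y + a / (m * n : ℕ))
  rw [sum_Ico_int (m * n) (fun a => f (y + a / (m * n : ℕ))), ← Finset.sum_product',
    ← sum_eq_sum_range_of_periodic (s := Finset.Ico (0 : ℤ) m ×ˢ Finset.Ico (0 : ℤ) n)
      (g := fun x => x.1 * n + x.2 * m) (f := fun a => f (y + a / (m * n : ℕ)))
      (Nat.mul_pos hm hn) (by simp) ?_ (periodic_div hf (Nat.mul_pos hm hn) y)]
  · refine Finset.sum_congr rfl fun x _ => ?_
    congr 1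
    push_cast; field_simp; ring
  · rintro ⟨a, b⟩ hab ⟨a', b'⟩ hab' hd
    simp only [Finset.mem_product, Finset.mem_Ico] at hab hab'
    push_cast at hd
    have e : a * n + b * m - (a' * n + b' * m) = (a - a') * n + (b - b') * m := by ring
    rw [e] at hd
    have d1 : (m : ℤ) ∣ a - a' := by
      refine hmn.dvd_of_dvd_mul_right ((Int.dvd_add_left ?_).1 ((Dvd.intro _ rfl).trans hd))
      exact Dvd.intro_left _ rfl
    have d2 : (n : ℤ) ∣ b - b' := by
      refine hmn.symm.dvd_of_dvd_mul_right
        ((Int.dvd_add_right ?_).1 ((Dvd.intro_left _ rfl).trans hd))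
      exact Dvd.intro_left _ rfl
    have z1 := Int.eq_zero_of_abs_lt_dvd d1 (by rw [abs_lt]; omega)
    have z2 := Int.eq_zero_of_abs_lt_dvd d2 (by rw [abs_lt]; omega)
    rw [Prod.mk.injEq]; omega

lemma sum_range_add_const (n : ℕ) (θ : ℝ) (hn : 0 < n) :
    ∑ k ∈ Finset.range n, ((k : ℝ) + θ) / n = ((n : ℝ) - 1) / 2 + θ := by
  have hn' : (n : ℝ) ≠ 0 := by positivity
  have h : ∀ m : ℕ, ∑ k ∈ Finset.range m, (k : ℝ) = m * (m - 1) / 2 := fun m => by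
    induction m with
    | zero => simp
    | succ m ih => rw [Finset.sum_range_succ, ih]; push_cast; ring
  rw [← Finset.sum_div, Finset.sum_add_distrib, h, Finset.sum_const, Finset.card_range,
    nsmul_eq_mul]
  field_simp

/-- Hermite's identity, for the fractional part, along either orientation `c = ±1`. -/
lemma sum_fract (n : ℕ) (hn : 0 < n) (y : ℝ) (c : ℤ) (hc : c * c = 1) :
    ∑ a ∈ Finset.Ico (0 : ℤ) n, Int.fract (y + (c * a : ℤ) / n)
      = ((n : ℝ) - 1) / 2 + Int.fract (n * y) := by
  have hn' : (n : ℝ) ≠ 0 := by positivity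
  have hn0 : (0 : ℝ) < n := by positivity
  have hper : Function.Periodic (Int.fract : ℝ → ℝ) 1 := fun x => Int.fract_add_one x
  set θ := Int.fract (n * y) with hθ
  have key := sum_eq_sum_range_of_periodic (s := Finset.Ico (0 : ℤ) n)
    (g := fun a => ⌊n * y⌋ + c * a) (f := fun a => Int.fract (θ / n + a / n)) hn (by simp)
    (fun a ha b hb hd => by
      rw [Finset.mem_Ico] at ha hb
      rw [add_sub_add_left_eq_sub, ← mul_sub] at hd
      have hd' : (n : ℤ) ∣ a - b := by
        have := hd.mul_left c
        rwa [← mul_assoc, hc, one_mul] at this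
      have := Int.eq_zero_of_abs_lt_dvd hd' (by rw [abs_lt]; omega)
      omega) (periodic_div hper hn (θ / n))
  have hl : ∀ a : ℤ, Int.fract (y + (c * a : ℤ) / n)
      = Int.fract (θ / n + ((⌊n * y⌋ + c * a : ℤ) : ℝ) / n) := fun a => by
    congr 1
    rw [hθ, ← Int.self_sub_floor]
    push_cast; field_simp; ring
  rw [Finset.sum_congr rfl fun a _ => hl a, key, ← sum_range_add_const n θ hn]
  refine Finset.sum_congr rfl fun k hk => ?_
  have hk' : ((k : ℝ) + 1) ≤ n := by exact_mod_cast Finset.mem_range.1 hk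
  have h0 := Int.fract_nonneg ((n : ℝ) * y)
  have h1 := Int.fract_lt_one ((n : ℝ) * y)
  rw [← add_div, Int.cast_natCast, add_comm θ, Int.fract_eq_self.2]
  constructor
  · positivity
  · rw [div_lt_one hn0]; linarith

/-- The distribution relation of the sawtooth function. -/
lemma periodSum_sawtooth {n : ℕ} (hn : 0 < n) (y : ℝ) :
    periodSum n sawtooth y = sawtooth (n * y) := by
  show ∑ a ∈ Finset.Ico (0 : ℤ) n, sawtooth (y + a / n) = _
  have h1 := sum_fract n hn y 1 rfl
  have h2 := sum_fract n hn (-y) (-1) rfl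
  have e : ∀ a : ℤ, sawtooth (y + a / n)
      = (Int.fract (y + (1 * a : ℤ) / n) - Int.fract (-y + (-1 * a : ℤ) / n)) / 2 := fun a => by
    rw [sawtooth_eq_fract]; push_cast; ring_nf
  rw [Finset.sum_congr rfl fun a _ => e a, ← Finset.sum_div, Finset.sum_sub_distrib, h1, h2,
    sawtooth_eq_fract]
  ring_nf

/-- `∑_{k mod n} ((k / n))²`. -/
def sawSq (n : ℕ) : ℝ := periodSum n (fun x => sawtooth x ^ 2) 0

lemma sawSq_eq {n : ℕ} (hn : 0 < n) : sawSq n = ((n : ℝ) - 1) * (n - 2) / (12 * n) := by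
  have hn' : (n : ℝ) ≠ 0 := by positivity
  have hn0 : (0 : ℝ) < n := by positivity
  have h : ∀ m : ℕ, ∑ k ∈ Finset.range m, ((k : ℝ) / n - 1 / 2) ^ 2
      = (m : ℝ) * (m - 1) * (2 * m - 1) / (6 * n ^ 2) - m * (m - 1) / (2 * n) + m / 4 := fun m => by
    induction m with
    | zero => simp
    | succ m ih => rw [Finset.sum_range_succ, ih]; push_cast; field_simp; ring
  have hs : sawSq n = ∑ k ∈ Finset.range n, ((k : ℝ) / n - 1 / 2) ^ 2 - 1 / 4 := by
    show ∑ a ∈ Finset.Ico (0 : ℤ) n, sawtooth (0 + a / n) ^ 2 = _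
    rw [sum_Ico_int n (fun a => sawtooth (0 + a / n) ^ 2)]
    obtain ⟨m, rfl⟩ := Nat.exists_eq_succ_of_ne_zero hn.ne'
    rw [Finset.sum_range_succ', Finset.sum_range_succ']
    have : ∀ k ∈ Finset.range m, sawtooth (0 + ((k + 1 : ℕ) : ℤ) / (m.succ : ℕ)) ^ 2
        = (((k + 1 : ℕ) : ℝ) / (m.succ : ℕ) - 1 / 2) ^ 2 := fun k hk => by
      have hk' : ((k : ℝ) + 1) < m.succ := by
        have := Finset.mem_range.1 hk
        exact_mod_cast Nat.succ_lt_succ this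
      rw [sawtooth_of_between (k := 0) (by push_cast; positivity)
        (by push_cast at *; rw [zero_add, zero_add, div_lt_one hn0]; exact hk')]
      push_cast; ring
    rw [Finset.sum_congr rfl this]
    simp [sawtooth_zero]
    norm_num
  rw [hs, h]
  field_simp
  ring

/-- The Dedekind sum `s(b, n)`, as a sum over the nonzero classes. -/
def sawCorr (n b : ℕ) : ℝ :=
  ∑ a ∈ Finset.Ioo (0 : ℤ) n, sawtooth (a / n) * sawtooth (b * (a / n))

lemma dedekindSum_eq_sawCorr {n : ℕ} (hn : 0 < n) (b : ℕ) :
    dedekindSum (b : ℤ) n = sawCorr n b := by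
  have hn' : (n : ℝ) ≠ 0 := by positivity
  obtain ⟨m, rfl⟩ := Nat.exists_eq_succ_of_ne_zero hn.ne'
  unfold dedekindSum sawCorr
  rw [Finset.sum_Icc_succ_top (by omega), div_self hn', show (1 : ℝ) = ((1 : ℤ) : ℝ) by simp,
    sawtooth_int, zero_mul, add_zero]
  refine Finset.sum_nbij' (fun k : ℕ => (k : ℤ)) Int.toNat ?_ ?_ ?_ ?_ ?_
  · intro k hk; rw [Finset.mem_Icc] at hk; rw [Finset.mem_Ioo]; omega
  · intro a ha; rw [Finset.mem_Ioo] at ha; rw [Finset.mem_Icc]; omega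
  · intro k _; simp
  · intro a ha; rw [Finset.mem_Ioo] at ha; exact Int.toNat_of_nonneg ha.1.le
  · intro k _
    push_cast
    congr 2
    ring

lemma puncturedSum_sawtooth_sq {n : ℕ} (hn : 0 < n) :
    ∑ a ∈ Finset.Ioo (0 : ℤ) n, sawtooth (a / n) ^ 2 = sawSq n := by
  have h := congrFun (puncturedSum_eq hn fun x => sawtooth x ^ 2) 0
  simp only [Pi.sub_apply, sawtooth_zero, puncturedSum, zero_add] at h
  rw [h, sawSq]; ring

lemma sawCorr_one {n : ℕ} (hn : 0 < n) : sawCorr n 1 = sawSq n := by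
  rw [← puncturedSum_sawtooth_sq hn, sawCorr]
  refine Finset.sum_congr rfl fun a _ => ?_
  rw [Nat.cast_one, one_mul, sq]

lemma sum_sawtooth {n : ℕ} (hn : 0 < n) :
    ∑ a ∈ Finset.Ioo (0 : ℤ) n, sawtooth (a / n) = 0 := by
  have h := congrFun (puncturedSum_eq hn sawtooth) 0
  simp only [Pi.sub_apply, sawtooth_zero, puncturedSum, zero_add, periodSum_sawtooth hn,
    mul_zero, sub_zero] at h
  exact h

lemma card_Ioo_int {n : ℕ} (hn : 0 < n) : ((Finset.Ioo (0 : ℤ) n).card : ℝ) = n - 1 := by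
  rw [Int.card_Ioo, sub_zero, show ((n : ℤ) - 1).toNat = n - 1 by omega, Nat.cast_sub hn,
    Nat.cast_one]

/-! ### Inclusion-exclusion and Dedekind reciprocity -/

local notation "I(" n ")" => Finset.Ioo (0 : ℤ) ((n : ℕ) : ℤ)

lemma puncturedSum_two {m n : ℕ} (hm : 0 < m) (hn : 0 < n) (h : Nat.Coprime m n)
    {f : ℝ → ℝ} (hf : Function.Periodic f 1) :
    puncturedSum m (puncturedSum n f)
      = periodSum (m * n) f - periodSum m f - periodSum n f + f := by
  rw [puncturedSum_eq hm, puncturedSum_eq hn, map_sub, periodSum_periodSum hf hm hn h]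
  ring

lemma puncturedSum_three {m n k : ℕ} (hm : 0 < m) (hn : 0 < n) (hk : 0 < k)
    (hmn : Nat.Coprime m n) (hmk : Nat.Coprime m k) (hnk : Nat.Coprime n k)
    {f : ℝ → ℝ} (hf : Function.Periodic f 1) :
    puncturedSum m (puncturedSum n (puncturedSum k f))
      = periodSum (m * (n * k)) f - periodSum (m * n) f - periodSum (m * k) f
        - periodSum (n * k) f + periodSum m f + periodSum n f + periodSum k f - f := by
  rw [puncturedSum_two hn hk hnk hf, puncturedSum_eq hm]
  simp only [map_sub, map_add]
  rw [periodSum_periodSum hf hm (Nat.mul_pos hn hk) (hmn.mul_right hmk),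
    periodSum_periodSum hf hm hn hmn, periodSum_periodSum hf hm hk hmk]
  ring

lemma puncturedSum_four {m n k r : ℕ} (hm : 0 < m) (hn : 0 < n) (hk : 0 < k) (hr : 0 < r)
    (hmn : Nat.Coprime m n) (hmk : Nat.Coprime m k) (hmr : Nat.Coprime m r)
    (hnk : Nat.Coprime n k) (hnr : Nat.Coprime n r) (hkr : Nat.Coprime k r)
    {f : ℝ → ℝ} (hf : Function.Periodic f 1) :
    puncturedSum m (puncturedSum n (puncturedSum k (puncturedSum r f)))
      = periodSum (m * (n * (k * r))) f - periodSum (m * (n * k)) f - periodSum (m * (n * r)) f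
        - periodSum (m * (k * r)) f - periodSum (n * (k * r)) f
        + periodSum (m * n) f + periodSum (m * k) f + periodSum (m * r) f
        + periodSum (n * k) f + periodSum (n * r) f + periodSum (k * r) f
        - periodSum m f - periodSum n f - periodSum k f - periodSum r f + f := by
  rw [puncturedSum_three hn hk hr hnk hnr hkr hf, puncturedSum_eq hm]
  simp only [map_sub, map_add]
  rw [periodSum_periodSum hf hm (Nat.mul_pos hn (Nat.mul_pos hk hr))
      (hmn.mul_right (hmk.mul_right hmr)),
    periodSum_periodSum hf hm (Nat.mul_pos hn hk) (hmn.mul_right hmk),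
    periodSum_periodSum hf hm (Nat.mul_pos hn hr) (hmn.mul_right hmr),
    periodSum_periodSum hf hm (Nat.mul_pos hk hr) (hmk.mul_right hmr),
    periodSum_periodSum hf hm hn hmn, periodSum_periodSum hf hm hk hmk,
    periodSum_periodSum hf hm hr hmr]
  ring

lemma sawtooth_sq_periodic : Function.Periodic (fun x => sawtooth x ^ 2) 1 := fun x => by
  show sawtooth (x + 1) ^ 2 = _
  rw [sawtooth_periodic]

/-- Dedekind reciprocity: expand `∑ (⌊a/m + b/n⌋ - 1/2)²`, in which every term is `1/4`, by
`⌊x + y⌋ - 1/2 = ((x)) + ((y)) - ((x + y))`. -/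
theorem sawCorr_reciprocity {m n : ℕ} (hm : 0 < m) (hn : 0 < n) (h : Nat.Coprime m n) :
    sawCorr m n + sawCorr n m = -1 / 4 + ((m : ℝ) / n + n / m + 1 / (m * n)) / 12 := by
  have hm' : (m : ℝ) ≠ 0 := by positivity
  have hn' : (n : ℝ) ≠ 0 := by positivity
  have hm0 : (0 : ℝ) < m := by positivity
  have hn0 : (0 : ℝ) < n := by positivity
  have hquarter : ∑ a ∈ I(m), ∑ b ∈ I(n),
      (sawtooth (a / m) + sawtooth (b / n) - sawtooth (a / m + b / n)) ^ 2
      = ((m : ℝ) - 1) * (n - 1) / 4 := by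
    have : ∀ a ∈ I(m), ∀ b ∈ I(n),
        (sawtooth (a / m) + sawtooth (b / n) - sawtooth (a / m + b / n)) ^ 2 = 1 / 4 := by
      intro a ha b hb
      rw [Finset.mem_Ioo] at ha hb
      have a0 : (0 : ℝ) < a / m := div_pos (by exact_mod_cast ha.1) hm0
      have a1 : (a : ℝ) / m < 1 := (div_lt_one hm0).2 (by exact_mod_cast ha.2)
      have b0 : (0 : ℝ) < b / n := div_pos (by exact_mod_cast hb.1) hn0
      have b1 : (b : ℝ) / n < 1 := (div_lt_one hn0).2 (by exact_mod_cast hb.2)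
      rw [sawtooth_of_between (k := 0) (x := a / m) (by simpa using a0) (by simpa using a1),
        sawtooth_of_between (k := 0) (x := b / n) (by simpa using b0) (by simpa using b1)]
      rcases lt_trichotomy ((a : ℝ) / m + b / n) 1 with hlt | heq | hgt
      · rw [sawtooth_of_between (k := 0) (by push_cast; linarith) (by push_cast; linarith)]
        push_cast; ring
      · exfalso
        field_simp at heq
        have heq' : a * n + m * b = m * n := by exact_mod_cast heq
        have hd : (m : ℤ) ∣ a * n := ⟨n - b, by linear_combination heq'⟩
        have hd' := (Nat.isCoprime_iff_coprime.2 h).dvd_of_dvd_mul_right hd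
        have := Int.le_of_dvd ha.1 hd'
        omega
      · rw [sawtooth_of_between (k := 1) (by push_cast; linarith) (by push_cast; linarith)]
        push_cast; ring
    rw [Finset.sum_congr rfl fun a ha => Finset.sum_congr rfl fun b hb => this a ha b hb]
    simp only [Finset.sum_const, nsmul_eq_mul, card_Ioo_int hm, card_Ioo_int hn]
    ring
  have hcross : ∀ {k r : ℕ}, 0 < k → 0 < r → ∑ a ∈ I(k), ∑ b ∈ I(r),
      sawtooth (a / k) * sawtooth (a / k + b / r)
      = sawCorr k r - sawCorr k 1 := fun {k r} hk hr => by
    have e := fun y => congrFun (puncturedSum_eq hr sawtooth) y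
    simp only [Pi.sub_apply, periodSum_sawtooth hr, puncturedSum] at e
    simp only [← Finset.mul_sum, e, mul_sub, Finset.sum_sub_distrib, sawCorr, Nat.cast_one,
      one_mul]
  have hT : ∑ a ∈ I(m), ∑ b ∈ I(n), sawtooth (a / m + b / n) ^ 2
      = sawSq (m * n) - sawSq m - sawSq n := by
    have e := congrFun (puncturedSum_two hm hn h sawtooth_sq_periodic) 0
    simp only [puncturedSum, Pi.sub_apply, Pi.add_apply, sawtooth_zero, zero_add] at e
    rw [e]; simp [sawSq]
  have hexp : ∀ x y t : ℝ, (x + y - t) ^ 2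
      = x ^ 2 + y ^ 2 + 2 * (x * y) - 2 * (x * t) - 2 * (y * t) + t ^ 2 := by intros; ring
  have hsw : ∑ a ∈ I(m), ∑ b ∈ I(n), sawtooth (b / n) * sawtooth (a / m + b / n)
      = sawCorr n m - sawCorr n 1 := by
    rw [Finset.sum_comm, ← hcross hn hm]
    simp only [add_comm]
  have hc := hcross hm hn
  rw [sawCorr_one hm] at hc
  rw [sawCorr_one hn] at hsw
  simp only [hexp, Finset.sum_add_distrib, Finset.sum_sub_distrib] at hquarter
  simp only [← Finset.mul_sum] at hc hsw hT hquarter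
  rw [hc, hsw, hT] at hquarter
  simp only [Finset.sum_const, nsmul_eq_mul, card_Ioo_int hm, card_Ioo_int hn,
    ← Finset.mul_sum, ← Finset.sum_mul, sum_sawtooth hm, puncturedSum_sawtooth_sq hm,
    puncturedSum_sawtooth_sq hn, sawSq_eq hm, sawSq_eq hn,
    sawSq_eq (Nat.mul_pos hm hn)] at hquarter
  have key : sawCorr m n + sawCorr n m = (-((m : ℝ) - 1) * (n - 1) / 4
      + ((n - 1) * ((m - 1) * (m - 2) / (12 * m)) + (m - 1) * ((n - 1) * (n - 2) / (12 * n)))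
      + 2 * ((m - 1) * (m - 2) / (12 * m)) + 2 * ((n - 1) * (n - 2) / (12 * n))
      + ((m * n - 1) * (m * n - 2) / (12 * (m * n)) - (m - 1) * (m - 2) / (12 * m)
        - (n - 1) * (n - 2) / (12 * n))) / 2 := by
    push_cast at hquarter
    linear_combination (-1 / 2) * hquarter
  rw [key]
  field_simp
  ring

/-- The correlation of `((a/m))` with `((T))`, `T = a/m + b/n + c/k + d/r`, is an alternating sum
of Dedekind sums. -/
lemma sum_cross {m n k r : ℕ} (hn : 0 < n) (hk : 0 < k) (hr : 0 < r)
    (hnk : Nat.Coprime n k) (hnr : Nat.Coprime n r) (hkr : Nat.Coprime k r) :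
    ∑ a ∈ I(m), ∑ b ∈ I(n), ∑ c ∈ I(k), ∑ d ∈ I(r),
      sawtooth (a / m) * sawtooth (a / m + b / n + c / k + d / r)
      = sawCorr m (n * (k * r)) - sawCorr m (n * k) - sawCorr m (n * r) - sawCorr m (k * r)
        + sawCorr m n + sawCorr m k + sawCorr m r - sawCorr m 1 := by
  have e := fun y => congrFun (puncturedSum_three hn hk hr hnk hnr hkr sawtooth_periodic) y
  simp only [Pi.sub_apply, Pi.add_apply, periodSum_sawtooth hn, periodSum_sawtooth hk,
    periodSum_sawtooth hr, periodSum_sawtooth (Nat.mul_pos hn (Nat.mul_pos hk hr)),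
    periodSum_sawtooth (Nat.mul_pos hn hk), periodSum_sawtooth (Nat.mul_pos hn hr),
    periodSum_sawtooth (Nat.mul_pos hk hr), puncturedSum] at e
  simp only [← Finset.mul_sum, e]
  simp only [mul_sub, mul_add, Finset.sum_sub_distrib, Finset.sum_add_distrib, sawCorr,
    Nat.cast_one, one_mul]

/-- The second moment of `((x₁)) + ((x₂)) + ((x₃)) + ((x₄)) - ((x₁ + x₂ + x₃ + x₄))` over
`x = (a/m, b/n, c/k, d/r)`, in terms of Dedekind sums. -/
lemma sum_sq_four {m n k r : ℕ} (hm : 0 < m) (hn : 0 < n) (hk : 0 < k) (hr : 0 < r)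
    (hmn : Nat.Coprime m n) (hmk : Nat.Coprime m k) (hmr : Nat.Coprime m r)
    (hnk : Nat.Coprime n k) (hnr : Nat.Coprime n r) (hkr : Nat.Coprime k r) :
    ∑ a ∈ I(m), ∑ b ∈ I(n), ∑ c ∈ I(k), ∑ d ∈ I(r),
      (sawtooth (a / m) + sawtooth (b / n) + sawtooth (c / k) + sawtooth (d / r)
        - sawtooth (a / m + b / n + c / k + d / r)) ^ 2
      = sawSq m * ((n - 1) * (k - 1) * (r - 1)) + sawSq n * ((m - 1) * (k - 1) * (r - 1))
        + sawSq k * ((m - 1) * (n - 1) * (r - 1)) + sawSq r * ((m - 1) * (n - 1) * (k - 1))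
        - 2 * (sawCorr m (n * (k * r)) - sawCorr m (n * k) - sawCorr m (n * r)
            - sawCorr m (k * r) + sawCorr m n + sawCorr m k + sawCorr m r - sawSq m)
        - 2 * (sawCorr n (m * (k * r)) - sawCorr n (m * k) - sawCorr n (m * r)
            - sawCorr n (k * r) + sawCorr n m + sawCorr n k + sawCorr n r - sawSq n)
        - 2 * (sawCorr k (m * (n * r)) - sawCorr k (m * n) - sawCorr k (m * r)
            - sawCorr k (n * r) + sawCorr k m + sawCorr k n + sawCorr k r - sawSq k)
        - 2 * (sawCorr r (m * (n * k)) - sawCorr r (m * n) - sawCorr r (m * k)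
            - sawCorr r (n * k) + sawCorr r m + sawCorr r n + sawCorr r k - sawSq r)
        + (sawSq (m * (n * (k * r))) - sawSq (m * (n * k)) - sawSq (m * (n * r))
          - sawSq (m * (k * r)) - sawSq (n * (k * r))
          + sawSq (m * n) + sawSq (m * k) + sawSq (m * r) + sawSq (n * k) + sawSq (n * r)
          + sawSq (k * r) - sawSq m - sawSq n - sawSq k - sawSq r) := by
  have hT : ∑ a ∈ I(m), ∑ b ∈ I(n), ∑ c ∈ I(k), ∑ d ∈ I(r),
      sawtooth (a / m + b / n + c / k + d / r) ^ 2
      = sawSq (m * (n * (k * r))) - sawSq (m * (n * k)) - sawSq (m * (n * r))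
          - sawSq (m * (k * r)) - sawSq (n * (k * r))
          + sawSq (m * n) + sawSq (m * k) + sawSq (m * r) + sawSq (n * k) + sawSq (n * r)
          + sawSq (k * r) - sawSq m - sawSq n - sawSq k - sawSq r := by
    have e := congrFun (puncturedSum_four hm hn hk hr hmn hmk hmr hnk hnr hkr
      sawtooth_sq_periodic) 0
    simp only [puncturedSum, Pi.sub_apply, Pi.add_apply, sawtooth_zero, zero_add] at e
    rw [e]; simp [sawSq]
  have h1 := sum_cross (m := m) hn hk hr hnk hnr hkr
  have h2 : ∑ a ∈ I(m), ∑ b ∈ I(n), ∑ c ∈ I(k), ∑ d ∈ I(r),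
      sawtooth (b / n) * sawtooth (a / m + b / n + c / k + d / r)
      = sawCorr n (m * (k * r)) - sawCorr n (m * k) - sawCorr n (m * r)
        - sawCorr n (k * r) + sawCorr n m + sawCorr n k + sawCorr n r - sawCorr n 1 := by
    rw [Finset.sum_comm, ← sum_cross (m := n) hm hk hr hmk hmr hkr]
    refine Finset.sum_congr rfl fun b _ => Finset.sum_congr rfl fun a _ =>
      Finset.sum_congr rfl fun c _ => Finset.sum_congr rfl fun d _ => ?_
    congr 2; ring
  have h3 : ∑ a ∈ I(m), ∑ b ∈ I(n), ∑ c ∈ I(k), ∑ d ∈ I(r),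
      sawtooth (c / k) * sawtooth (a / m + b / n + c / k + d / r)
      = sawCorr k (m * (n * r)) - sawCorr k (m * n) - sawCorr k (m * r)
        - sawCorr k (n * r) + sawCorr k m + sawCorr k n + sawCorr k r - sawCorr k 1 := by
    rw [Finset.sum_congr rfl fun a _ => Finset.sum_comm, Finset.sum_comm,
      ← sum_cross (m := k) hm hn hr hmn hmr hnr]
    refine Finset.sum_congr rfl fun b _ => Finset.sum_congr rfl fun a _ =>
      Finset.sum_congr rfl fun c _ => Finset.sum_congr rfl fun d _ => ?_
    congr 2; ring
  have h4 : ∑ a ∈ I(m), ∑ b ∈ I(n), ∑ c ∈ I(k), ∑ d ∈ I(r),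
      sawtooth (d / r) * sawtooth (a / m + b / n + c / k + d / r)
      = sawCorr r (m * (n * k)) - sawCorr r (m * n) - sawCorr r (m * k)
        - sawCorr r (n * k) + sawCorr r m + sawCorr r n + sawCorr r k - sawCorr r 1 := by
    rw [Finset.sum_congr rfl fun a _ => (Finset.sum_congr rfl fun b _ => Finset.sum_comm).trans
      Finset.sum_comm, Finset.sum_comm, ← sum_cross (m := r) hm hn hk hmn hmk hnk]
    refine Finset.sum_congr rfl fun b _ => Finset.sum_congr rfl fun a _ =>
      Finset.sum_congr rfl fun c _ => Finset.sum_congr rfl fun d _ => ?_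
    congr 2; ring
  have hexp : ∀ x y z w t : ℝ, (x + y + z + w - t) ^ 2
      = x ^ 2 + y ^ 2 + z ^ 2 + w ^ 2
        + 2 * (x * y) + 2 * (x * z) + 2 * (x * w) + 2 * (y * z) + 2 * (y * w) + 2 * (z * w)
        - 2 * (x * t) - 2 * (y * t) - 2 * (z * t) - 2 * (w * t) + t ^ 2 := by intros; ring
  rw [sawCorr_one hm] at h1
  rw [sawCorr_one hn] at h2
  rw [sawCorr_one hk] at h3
  rw [sawCorr_one hr] at h4
  simp only [hexp, Finset.sum_add_distrib, Finset.sum_sub_distrib]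
  simp only [← Finset.mul_sum] at h1 h2 h3 h4 hT ⊢
  rw [h1, h2, h3, h4, hT]
  simp only [Finset.sum_const, nsmul_eq_mul, card_Ioo_int hm,
    card_Ioo_int hn, card_Ioo_int hk, card_Ioo_int hr, ← Finset.mul_sum, ← Finset.sum_mul,
    sum_sawtooth hm, sum_sawtooth hn, sum_sawtooth hk, sum_sawtooth hr,
    puncturedSum_sawtooth_sq hm, puncturedSum_sawtooth_sq hn, puncturedSum_sawtooth_sq hk,
    puncturedSum_sawtooth_sq hr]
  ring

/-! ### The second moment and the tetrahedron -/

lemma sum_admSet (p : Fin 4 → ℕ) (F : (Fin 4 → ℤ) → ℝ) :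
    ∑ l ∈ admSet p, F l = ∑ a ∈ Finset.Ioo (0 : ℤ) (p 0), ∑ b ∈ Finset.Ioo (0 : ℤ) (p 1),
      ∑ c ∈ Finset.Ioo (0 : ℤ) (p 2), ∑ d ∈ Finset.Ioo (0 : ℤ) (p 3), F ![a, b, c, d] := by
  simp only [← Finset.sum_product']
  refine Finset.sum_nbij' (fun l => (l 0, l 1, l 2, l 3))
    (fun x => ![x.1, x.2.1, x.2.2.1, x.2.2.2]) ?_ ?_ ?_ ?_ ?_
  · intro l hl
    have := mem_admSet.1 hl
    simp only [Finset.mem_product, Finset.mem_Ioo]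
    exact ⟨this 0, this 1, this 2, this 3⟩
  · rintro ⟨a, b, c, d⟩ hx
    simp only [Finset.mem_product, Finset.mem_Ioo] at hx
    rw [mem_admSet]
    intro j
    fin_cases j
    exacts [hx.1, hx.2.1, hx.2.2.1, hx.2.2.2]
  · intro l _
    funext j
    fin_cases j <;> rfl
  · intro x _; rfl
  · intro l _
    congr 1
    funext j
    fin_cases j <;> rfl

lemma div_eq_mul_cof_div (hpos : ∀ j, 0 < p j) (l : Fin 4 → ℤ) (j : Fin 4) :
    (l j : ℝ) / p j = ((l j * cof p j : ℤ) : ℝ) / bigP p := by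
  have h1 : (p j : ℝ) ≠ 0 := by exact_mod_cast (hpos j).ne'
  have h2 : (bigP p : ℝ) ≠ 0 := by exact_mod_cast (bigP_pos hpos).ne'
  have h3 : (p j : ℝ) * cof p j = bigP p := by exact_mod_cast mul_cof p j
  rw [div_eq_div_iff h1 h2, ← h3]
  push_cast; ring

lemma sum_div_eq_height_div (hpos : ∀ j, 0 < p j) (l : Fin 4 → ℤ) :
    ∑ j, (l j : ℝ) / p j = (height p l : ℝ) / bigP p := by
  simp only [div_eq_mul_cof_div hpos, ← Finset.sum_div, height, Int.cast_sum]

/-- With `T = ∑ xⱼ`, `xⱼ = ℓⱼ / pⱼ`, the quantity `∑ ((xⱼ)) - ((T))` equals `⌊T⌋ - 3/2`, whose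
square is `9/4` for `⌊T⌋ = 0, 3` and `1/4` for `⌊T⌋ = 1, 2`. -/
lemma sq_sum_sawtooth_sub (hpos : ∀ j, 0 < p j)
    (hcop : ∀ j k, j ≠ k → Nat.Coprime (p j) (p k)) {l : Fin 4 → ℤ} (hl : Admissible p l) :
    (∑ j, sawtooth (l j / p j) - sawtooth (∑ j, (l j : ℝ) / p j)) ^ 2
      = 1 / 4 + 2 * (if height p l < bigP p then 1 else 0)
        + 2 * (if 3 * (bigP p : ℤ) < height p l then 1 else 0) := by
  have hP : (0 : ℝ) < bigP p := by exact_mod_cast bigP_pos hpos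
  have hx0 : ∀ j, (0 : ℝ) < l j / p j := fun j =>
    div_pos (by exact_mod_cast (hl j).1) (by exact_mod_cast hpos j)
  have hx1 : ∀ j, (l j : ℝ) / p j < 1 := fun j =>
    (div_lt_one (by exact_mod_cast hpos j)).2 (by exact_mod_cast (hl j).2)
  have hs : ∀ j, sawtooth (l j / p j) = l j / p j - 1 / 2 := fun j => by
    rw [sawtooth_of_between (k := 0) (by simpa using hx0 j) (by simpa using hx1 j)]
    simp
  have hsum : ∑ j, sawtooth (l j / p j) = ∑ j, (l j : ℝ) / p j - 2 := by
    rw [Finset.sum_congr rfl fun j _ => hs j, Finset.sum_sub_distrib]; norm_num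
  have hT0 : 0 < ∑ j, (l j : ℝ) / p j := Finset.sum_pos (fun j _ => hx0 j) ⟨0, Finset.mem_univ 0⟩
  have hT4 : ∑ j, (l j : ℝ) / p j < 4 := by
    have := hx1 0; have := hx1 1; have := hx1 2; have := hx1 3
    rw [Fin.sum_univ_four]; linarith
  have hne : ∀ k : ℤ, height p l ≠ k * bigP p := fun k h =>
    not_bigP_dvd_height hpos hcop hl ⟨k, by rw [h, mul_comm]⟩
  have n1 := hne 1
  have n2 := hne 2
  have n3 := hne 3
  rw [hsum]
  have hTh := sum_div_eq_height_div hpos l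
  generalize ∑ j, (l j : ℝ) / p j = T at *
  have hlt : ∀ {k : ℤ}, T < k ↔ height p l < k * bigP p := fun {k} => by
    rw [hTh, div_lt_iff₀ hP]; exact_mod_cast Iff.rfl
  have hgt : ∀ {k : ℤ}, (k : ℝ) < T ↔ k * bigP p < height p l := fun {k} => by
    rw [hTh, lt_div_iff₀ hP]; exact_mod_cast Iff.rfl
  have h0 := (hgt (k := 0)).1 (by simpa using hT0)
  have h4 := (hlt (k := 4)).1 (by simpa using hT4)
  have hval : ∀ k : ℤ, k * bigP p < height p l → height p l < (k + 1) * bigP p →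
      sawtooth T = T - k - 1 / 2 := fun k a b =>
    sawtooth_of_between (hgt.2 a) (by have := hlt.2 b; push_cast at this; exact this)
  have hP' : (0 : ℤ) < bigP p := by exact_mod_cast bigP_pos hpos
  by_cases c1 : height p l < bigP p
  · rw [hval 0 (by omega) (by omega), if_pos c1, if_neg (by omega)]
    push_cast; ring
  by_cases c2 : height p l < 2 * bigP p
  · rw [hval 1 (by omega) (by omega), if_neg c1, if_neg (by omega)]
    push_cast; ring
  by_cases c3 : height p l < 3 * bigP p
  · rw [hval 2 (by omega) (by omega), if_neg c1, if_neg (by omega)]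
    push_cast; ring
  · rw [hval 3 (by omega) (by omega), if_neg c1, if_pos (by omega)]
    push_cast; ring

lemma height_flip_neg_one (l : Fin 4 → ℤ) :
    height p (flip p (-1) l) = 4 * bigP p - height p l := by
  have : ∀ j, flip p (-1) l j * cof p j = bigP p - l j * cof p j := fun j => by
    rw [← mul_cof p j]
    show (if (-1 : ℤˣ) = 1 then l j else p j - l j) * cof p j = _
    rw [if_neg (by decide)]; ring
  simp only [height, this, Finset.sum_sub_distrib]
  simp

lemma sum_sq_eq_card_tetra (hpos : ∀ j, 0 < p j)
    (hcop : ∀ j k, j ≠ k → Nat.Coprime (p j) (p k)) :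
    ∑ l ∈ admSet p, (∑ j, sawtooth (l j / p j) - sawtooth (∑ j, (l j : ℝ) / p j)) ^ 2
      = (∏ j, ((p j : ℝ) - 1)) / 4 + 4 * (tetra p).card := by
  rw [Finset.sum_congr rfl fun l hl => sq_sum_sawtooth_sub hpos hcop (mem_admSet.1 hl)]
  have h1 : ∑ l ∈ admSet p, (if height p l < bigP p then (1 : ℝ) else 0) = (tetra p).card := by
    rw [tetra, Finset.card_filter]; push_cast; rfl
  -- the flip of all four coordinates exchanges the two extreme values of `⌊T⌋`
  have h2 : ∑ l ∈ admSet p, (if 3 * (bigP p : ℤ) < height p l then (1 : ℝ) else 0)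
      = (tetra p).card := by
    rw [← h1]
    refine Finset.sum_nbij' (flip p (-1)) (flip p (-1)) ?_ ?_ ?_ ?_ ?_
    · exact fun l hl => mem_admSet.2 ((mem_admSet.1 hl).flip _)
    · exact fun l hl => mem_admSet.2 ((mem_admSet.1 hl).flip _)
    · exact fun l _ => flip_flip_self _ l
    · exact fun l _ => flip_flip_self _ l
    · intro l _
      simp only [height_flip_neg_one]
      congr 1
      rw [eq_iff_iff]
      omega
  rw [Finset.sum_add_distrib, Finset.sum_add_distrib, ← Finset.mul_sum, ← Finset.mul_sum, h1, h2,
    Finset.sum_const, nsmul_eq_mul, card_admSet hpos]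
  ring

/-- The final formula, after the correlations with products of two or three of the moduli have
been cancelled: reciprocity turns what remains into an identity of rational functions. -/
lemma combination_eq_formula {x y z w : ℕ} (hx : 0 < x) (hy : 0 < y) (hz : 0 < z) (hw : 0 < w)
    (hxy : Nat.Coprime x y) (hxz : Nat.Coprime x z) (hxw : Nat.Coprime x w)
    (hyz : Nat.Coprime y z) (hyw : Nat.Coprime y w) (hzw : Nat.Coprime z w) :
    3 * (((x : ℝ) - 1) * (y - 1) * (z - 1) * (w - 1)) / 16
      - (sawSq x * ((y - 1) * (z - 1) * (w - 1)) + sawSq y * ((x - 1) * (z - 1) * (w - 1))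
        + sawSq z * ((x - 1) * (y - 1) * (w - 1)) + sawSq w * ((x - 1) * (y - 1) * (z - 1))
        - 2 * ((sawCorr x y + sawCorr y x) + (sawCorr x z + sawCorr z x)
          + (sawCorr x w + sawCorr w x) + (sawCorr y z + sawCorr z y)
          + (sawCorr y w + sawCorr w y) + (sawCorr z w + sawCorr w z))
        + 2 * (sawSq x + sawSq y + sawSq z + sawSq w)
        + (sawSq (x * (y * (z * w))) - sawSq (x * (y * z)) - sawSq (x * (y * w))
          - sawSq (x * (z * w)) - sawSq (y * (z * w))
          + sawSq (x * y) + sawSq (x * z) + sawSq (x * w) + sawSq (y * z) + sawSq (y * w)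
          + sawSq (z * w) - sawSq x - sawSq y - sawSq z - sawSq w)) / 4
      = -(3 / 8) + x * y * z * w / 12
        - x * y * z * w / 24 * ((1 + x) / x ^ 2 + (1 + y) / y ^ 2 + (1 + z) / z ^ 2
          + (1 + w) / w ^ 2)
        - 1 / (24 * (x * y * z * w)) * (1 - (x + y + z + w))
        + x * y * z * w / 24 * (1 / (x ^ 2 * y) + 1 / (x ^ 2 * z) + 1 / (x ^ 2 * w)
          + (1 / (y ^ 2 * x) + 1 / (y ^ 2 * z) + 1 / (y ^ 2 * w))
          + (1 / (z ^ 2 * x) + 1 / (z ^ 2 * y) + 1 / (z ^ 2 * w))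
          + (1 / (w ^ 2 * x) + 1 / (w ^ 2 * y) + 1 / (w ^ 2 * z))) := by
  have hx' : (x : ℝ) ≠ 0 := by positivity
  have hy' : (y : ℝ) ≠ 0 := by positivity
  have hz' : (z : ℝ) ≠ 0 := by positivity
  have hw' : (w : ℝ) ≠ 0 := by positivity
  have hG : ∀ {n : ℕ}, 0 < n → sawSq n = ((n : ℝ) - 1) * (n - 2) / (12 * n) := sawSq_eq
  rw [sawCorr_reciprocity hx hy hxy, sawCorr_reciprocity hx hz hxz,
    sawCorr_reciprocity hx hw hxw, sawCorr_reciprocity hy hz hyz, sawCorr_reciprocity hy hw hyw,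
    sawCorr_reciprocity hz hw hzw, hG hx, hG hy, hG hz, hG hw,
    hG (n := x * (y * (z * w))) (by positivity), hG (n := x * (y * z)) (by positivity),
    hG (n := x * (y * w)) (by positivity), hG (n := x * (z * w)) (by positivity),
    hG (n := y * (z * w)) (by positivity), hG (n := x * y) (by positivity),
    hG (n := x * z) (by positivity), hG (n := x * w) (by positivity),
    hG (n := y * z) (by positivity), hG (n := y * w) (by positivity),
    hG (n := z * w) (by positivity)]
  push_cast
  generalize (x : ℝ) = x at *
  generalize (y : ℝ) = y at *
  generalize (z : ℝ) = z at *
  generalize (w : ℝ) = w at *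
  field_simp
  ring

end

end SeifertEichler

theorem mainTheorem4 (p : Fin 4 → ℕ) (hpos : ∀ j, 0 < p j)
    (hcop : ∀ j k, j ≠ k → Nat.Coprime (p j) (p k)) (N : ℤ) :
    (∀ l : Fin 4 → ℤ, SeifertEichler.Admissible p l →
      ∃ L : ℂ, SeifertEichler.HasLimitingValue
        (SeifertEichler.eichlerIntegral p l) (N : ℝ) L) ∧
    (SeifertEichler.gammaCount p N : ℝ) =
      -(3 / 8 : ℝ) + (SeifertEichler.bigP p : ℝ) / 12
        - (SeifertEichler.bigP p : ℝ) / 24 * ∑ j, (1 + (p j : ℝ)) / (p j : ℝ) ^ 2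
        - 1 / (24 * (SeifertEichler.bigP p : ℝ)) * (1 - ∑ j, (p j : ℝ))
        + (SeifertEichler.bigP p : ℝ) / 24 *
            ∑ j, ∑ k, (if j ≠ k then 1 / ((p j : ℝ) ^ 2 * (p k : ℝ)) else 0)
        + 1 / 2 * ∑ j,
            SeifertEichler.dedekindSum ((SeifertEichler.bigP p / p j : ℕ) : ℤ) (p j)
        - 1 / 2 * ∑ j, ∑ k, (if j ≠ k then
            SeifertEichler.dedekindSum ((SeifertEichler.bigP p / (p j * p k) : ℕ) : ℤ) (p j)
            else 0) := by
  refine ⟨fun l _ => ⟨_, SeifertEichler.hasLimitingValue_eichlerIntegral hpos l N⟩, ?_⟩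
  have hP : SeifertEichler.bigP p = p 0 * p 1 * p 2 * p 3 := by
    rw [SeifertEichler.bigP, Fin.prod_univ_four]
  have hsq := SeifertEichler.sum_sq_eq_card_tetra hpos hcop
  rw [SeifertEichler.sum_admSet] at hsq
  simp only [Fin.sum_univ_four, Fin.prod_univ_four, Matrix.cons_val_zero, Matrix.cons_val_one,
    Matrix.cons_val] at hsq
  have c01 := hcop 0 1 (by decide)
  have c02 := hcop 0 2 (by decide)
  have c03 := hcop 0 3 (by decide)
  have c12 := hcop 1 2 (by decide)
  have c13 := hcop 1 3 (by decide)
  have c23 := hcop 2 3 (by decide)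
  have q0 := hpos 0
  have q1 := hpos 1
  have q2 := hpos 2
  have q3 := hpos 3
  rw [SeifertEichler.sum_sq_four q0 q1 q2 q3 c01 c02 c03 c12 c13 c23] at hsq
  have hdiv : ∀ {a b c : ℕ}, 0 < a → c = a * b → c / a = b := fun {a b c} ha h => by
    rw [h, Nat.mul_div_cancel_left _ ha]
  rw [SeifertEichler.gammaCount_eq hpos hcop]
  simp only [Fin.sum_univ_four, Fin.prod_univ_four, SeifertEichler.dedekindSum_eq_sawCorr (hpos _),
    ne_eq, not_true_eq_false, if_false, Fin.reduceEq, not_false_eq_true, if_true, hP]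
  rw [hdiv q0 (show _ = p 0 * (p 1 * (p 2 * p 3)) by ring),
    hdiv q1 (show _ = p 1 * (p 0 * (p 2 * p 3)) by ring),
    hdiv q2 (show _ = p 2 * (p 0 * (p 1 * p 3)) by ring),
    hdiv q3 (show _ = p 3 * (p 0 * (p 1 * p 2)) by ring),
    hdiv (Nat.mul_pos q0 q1) (show _ = p 0 * p 1 * (p 2 * p 3) by ring),
    hdiv (Nat.mul_pos q0 q2) (show _ = p 0 * p 2 * (p 1 * p 3) by ring),
    hdiv (Nat.mul_pos q0 q3) (show _ = p 0 * p 3 * (p 1 * p 2) by ring),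
    hdiv (Nat.mul_pos q1 q0) (show _ = p 1 * p 0 * (p 2 * p 3) by ring),
    hdiv (Nat.mul_pos q1 q2) (show _ = p 1 * p 2 * (p 0 * p 3) by ring),
    hdiv (Nat.mul_pos q1 q3) (show _ = p 1 * p 3 * (p 0 * p 2) by ring),
    hdiv (Nat.mul_pos q2 q0) (show _ = p 2 * p 0 * (p 1 * p 3) by ring),
    hdiv (Nat.mul_pos q2 q1) (show _ = p 2 * p 1 * (p 0 * p 3) by ring),
    hdiv (Nat.mul_pos q2 q3) (show _ = p 2 * p 3 * (p 0 * p 1) by ring),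
    hdiv (Nat.mul_pos q3 q0) (show _ = p 3 * p 0 * (p 1 * p 2) by ring),
    hdiv (Nat.mul_pos q3 q1) (show _ = p 3 * p 1 * (p 0 * p 2) by ring),
    hdiv (Nat.mul_pos q3 q2) (show _ = p 3 * p 2 * (p 0 * p 1) by ring)]
  have hrat := SeifertEichler.combination_eq_formula q0 q1 q2 q3 c01 c02 c03 c12 c13 c23
  push_cast at hsq ⊢
  generalize ((p 0 : ℕ) : ℝ) = x at *
  generalize ((p 1 : ℕ) : ℝ) = y at *
  generalize ((p 2 : ℕ) : ℝ) = z at *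
  generalize ((p 3 : ℕ) : ℝ) = w at *
  linear_combination (1 / 4) * hsq + hrat
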